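/- Consider an $N$-player game in which player $i$ chooses a matrix from $\mathcal X_i=\{X_i\in\mathbb C^{M_i\times M_i}\ \text{Hermitian}: X_i\succcurlyeq 0,\ \|X_i\|\le A_i\}$, where $A_i>0$ and $\|\cdot\|$ is the nuclear norm. Write $\mathcal X=\prod_i\mathcal X_i$, and identify a profile $X=(X_1,\dots,X_N)$ with the block-diagonal matrix $\mathrm{diag}(X_1,\dots,X_N)$. The utilities $u_i:\mathcal X\to\mathbb R$ are concave in $X_i$ (for fixed actions of the other players in $\mathcal X$) and twice continuously differentiable on $\mathcal X$. Let $V_i(X)=\nabla_{X_i}u_i(X)$, the Hermitian matrix with $\mathrm{tr}(V_i(X)H)=\mathrm{D}_{X_i}u_i(X)[H]$ for all Hermitian $H$. Let the Hessian of the game be the block matrix $D(X)=(D_{ij}(X))_{i,j}$ with $$D_{ij}(X)=\tfrac12\nabla_{X_i}\nabla_{X_j}u_j(X)+\tfrac12\bigl[\nabla_{X_j}\nabla_{X_i}u_i(X)\bigr]^\dagger,$$ and write $D(X)\prec0$ if its quadratic form is negative on all nonzero profiles of Hermitian matrices. Matrix exponential learning (MXL) with step-sizes $\gamma_n>0$ is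 the recursion, for $n=0,1,\dots$, $$X_i(n)=A_i\frac{\exp(Y_i(n))}{1+\|\exp(Y_i(n))\|},\qquad Y_i(n+1)=Y_i(n)+\gamma_n\bigl(V_i(X(n))+Z_i(n)\bigr),$$ with arbitrary (possibly random) Hermitian $Y_i(0)$. The noise $Z(n)$ is Hermitian and satisfies, for every $n$ and for a constant $\sigma>0$, $$\mathbb E[Z(n)\mid X(0),\dots,X(n)]=0,\qquad \mathbb E\bigl[\|Z(n)\|_*^p\mid X(0),\dots,X(n)\bigr]\le\frac{p!}{2}\,\sigma^p\quad(p=1,2,\dots),$$ where $\|Z\|_*$ is the largest absolute value of an eigenvalue of the block-diagonal matrix $Z$. Let $X^*\in\mathcal X$ be a Nash equilibrium of the game, that is, $u_i(X^*)\ge u_i(X_i;X^*_{-i})$ for all $i$ and all $X_i\in\mathcal X_i$, and suppose that $D(X^*)\prec0$. Then MXL converges locally to $X^*$ with arbitrarily high probability if the step-sizes are small enough: for every $\sigma>0$ and every $\varepsilon>0$ there are a neighborhood $U_\varepsilon$ of $X^*$ and a $\delta>0$ such that, for every sequence $\gamma_n>0$ with $\sum_n\gamma_n=\infty$, $\sum_n\gamma_n^{1+q}<\infty$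 for some $q\in(0,1)$, and $\sum_n\gamma_n^2\le\delta$, and for every run of MXL as above with step-sizes $\gamma_n$ and noise constant $\sigma$ such that $\mathbb P(X(0)\in U_\varepsilon)>0$, $$\mathbb P\bigl(X(n)\to X^*\,\big|\,X(0)\in U_\varepsilon\bigr)\ge1-\varepsilon .$$ -/

import Mathlib

open MeasureTheory ProbabilityTheory Filter Topology
open scoped Matrix.Norms.L2Operator ComplexOrder

noncomputable section

/-- The real vector space of `m × m` complex Hermitian matrices.  It carries the spectral norm
`‖A‖ = max_j |eig_j A|`, i.e. the dual of the nuclear norm. -/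
abbrev Herm (m : ℕ) : Type := selfAdjoint (Matrix (Fin m) (Fin m) ℂ)

/-- Profiles `(X₁, …, X_N)` of Hermitian matrices, identified with block-diagonal matrices.  The
norm is the maximum of the spectral norms of the blocks, i.e. the spectral norm of the
block-diagonal matrix. -/
abbrev Profile {N : ℕ} (M : Fin N → ℕ) : Type := (i : Fin N) → Herm (M i)

instance instFiniteDimensionalHerm (m : ℕ) : FiniteDimensional ℝ (Herm m) := by
  have h : FiniteDimensional ℝ (selfAdjoint.submodule ℝ (Matrix (Fin m) (Fin m) ℂ)) :=
    inferInstance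
  exact h

instance instCompleteSpaceHerm (m : ℕ) : CompleteSpace (Herm m) :=
  FiniteDimensional.complete ℝ (Herm m)

namespace Herm

variable {m : ℕ}

theorem isHermitian (X : Herm m) : (X : Matrix (Fin m) (Fin m) ℂ).IsHermitian :=
  selfAdjoint.mem_iff.1 X.2

/-- The nuclear (trace) norm `∑_j |eig_j X|`. -/
def nuclearNorm (X : Herm m) : ℝ := ∑ j, |X.isHermitian.eigenvalues j|

/-- The matrix exponential of a Hermitian matrix. -/
def exp (Y : Herm m) : Herm m :=
  ⟨NormedSpace.exp (Y : Matrix (Fin m) (Fin m) ℂ),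
    selfAdjoint.mem_iff.2 (Matrix.IsHermitian.exp Y.isHermitian)⟩

/-- The trace pairing `(A, B) ↦ tr (A B)` on Hermitian matrices (it is real-valued). -/
def tracePairing (m : ℕ) : Herm m →ₗ[ℝ] Module.Dual ℝ (Herm m) :=
  LinearMap.mk₂ ℝ
    (fun A B => ((A : Matrix (Fin m) (Fin m) ℂ) * (B : Matrix (Fin m) (Fin m) ℂ)).trace.re)
    (by intro A B C; simp [add_mul])
    (by intro c A B; simp)
    (by intro A B C; simp [mul_add])
    (by intro c A B; simp)

theorem tracePairing_injective (m : ℕ) : Function.Injective (tracePairing m) := by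
  rw [injective_iff_map_eq_zero]
  intro A hA
  have h : ((A : Matrix (Fin m) (Fin m) ℂ) * (A : Matrix (Fin m) (Fin m) ℂ)).trace.re = 0 :=
    LinearMap.congr_fun hA A
  have h2 : ((A : Matrix (Fin m) (Fin m) ℂ) * (A : Matrix (Fin m) (Fin m) ℂ)).trace.re
      = ∑ i, ∑ j, Complex.normSq ((A : Matrix (Fin m) (Fin m) ℂ) i j) := by
    simp only [Matrix.trace, Matrix.diag, Matrix.mul_apply, Complex.re_sum]
    refine Finset.sum_congr rfl fun i _ => Finset.sum_congr rfl fun j _ => ?_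
    have hs : star ((A : Matrix (Fin m) (Fin m) ℂ) i j) = (A : Matrix (Fin m) (Fin m) ℂ) j i :=
      A.isHermitian.apply j i
    rw [← hs, Complex.star_def, Complex.mul_conj]
    simp
  rw [h2] at h
  have h3 : ∀ i j, (A : Matrix (Fin m) (Fin m) ℂ) i j = 0 := by
    intro i j
    have h4 := (Finset.sum_eq_zero_iff_of_nonneg (fun i _ =>
      Finset.sum_nonneg fun j _ => Complex.normSq_nonneg _)).1 h i (Finset.mem_univ i)
    have h5 := (Finset.sum_eq_zero_iff_of_nonneg (fun j _ =>
      Complex.normSq_nonneg _)).1 h4 j (Finset.mem_univ j)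
    exact Complex.normSq_eq_zero.1 h5
  exact Subtype.ext (Matrix.ext h3)

/-- The Hermitian matrix `V` that represents a real linear functional `φ` on Hermitian matrices
through the trace, `φ H = tr (V H)`. -/
def ofDual (φ : Module.Dual ℝ (Herm m)) : Herm m :=
  ((tracePairing m).linearEquivOfInjective (tracePairing_injective m)
    (Subspace.dual_finrank_eq (K := ℝ) (V := Herm m)).symm).symm φ

theorem trace_ofDual_mul (φ : Module.Dual ℝ (Herm m)) (H : Herm m) :
    ((ofDual φ : Matrix (Fin m) (Fin m) ℂ) * (H : Matrix (Fin m) (Fin m) ℂ)).trace.re = φ H := by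
  have h : tracePairing m (ofDual φ) = φ :=
    ((tracePairing m).linearEquivOfInjective (tracePairing_injective m)
      (Subspace.dual_finrank_eq (K := ℝ) (V := Herm m)).symm).apply_symm_apply φ
  exact LinearMap.congr_fun h H

end Herm

/-- The action set `{X ≽ 0 : ‖X‖ ≤ A}`, where `‖X‖` is the nuclear norm. -/
def actionSet (m : ℕ) (A : ℝ) : Set (Herm m) :=
  {X | (X : Matrix (Fin m) (Fin m) ℂ).PosSemidef ∧ X.nuclearNorm ≤ A}

/-- The set of feasible action profiles. -/
def feasibleSet {N : ℕ} (M : Fin N → ℕ) (A : Fin N → ℝ) : Set (Profile M) :=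
  {X | ∀ i, X i ∈ actionSet (M i) (A i)}

/-- An `N`-player concave semidefinite game.  The utilities are functions on the feasible set (their
values elsewhere are never used), individually concave and twice continuously differentiable. -/
structure SemidefiniteGame (N : ℕ) where
  M : Fin N → ℕ
  A : Fin N → ℝ
  A_pos : ∀ i, 0 < A i
  u : Fin N → Profile M → ℝ
  concave : ∀ i, ∀ X ∈ feasibleSet M A,
    ConcaveOn ℝ (actionSet (M i) (A i)) fun Xi => u i (Function.update X i Xi)
  smooth : ∀ i, ContDiffOn ℝ 2 (u i) (feasibleSet M A)

namespace SemidefiniteGame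

variable {N : ℕ} (G : SemidefiniteGame N)

/-- The set of feasible action profiles of the game. -/
def feasible : Set (Profile G.M) := feasibleSet G.M G.A

/-- Nash equilibrium: a feasible profile from which no unilateral deviation is profitable. -/
def IsNash (Xs : Profile G.M) : Prop :=
  Xs ∈ G.feasible ∧ ∀ i, ∀ Xi ∈ actionSet (G.M i) (G.A i),
    G.u i (Function.update Xs i Xi) ≤ G.u i Xs

/-- The individual payoff gradient `V_i(X) = ∇_{X_i} u_i(X)`: the Hermitian matrix such that
`tr (V_i(X) H)` is the derivative of `u_i` at `X` in the direction `H` of the `i`-th block.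
Derivatives are taken within the feasible set, which has non-empty interior. -/
def V (X : Profile G.M) : Profile G.M := fun i =>
  Herm.ofDual ((fderivWithin ℝ (G.u i) G.feasible X : Profile G.M →ₗ[ℝ] ℝ) ∘ₗ
    LinearMap.single ℝ (fun j => Herm (G.M j)) i)

/-- `∇_{X_i} ∇_{X_j} u_k (X)` as a bilinear form in a direction `H` of the `i`-th block and a
direction `K` of the `j`-th block. -/
def mixedDeriv (k i j : Fin N) (X : Profile G.M) (H : Herm (G.M i)) (K : Herm (G.M j)) : ℝ :=
  fderivWithin ℝ (fderivWithin ℝ (G.u k) G.feasible) G.feasible X (Pi.single i H) (Pi.single j K)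

/-- The block `D_{ij}(X) = ½ ∇_{X_i} ∇_{X_j} u_j(X) + ½ [∇_{X_j} ∇_{X_i} u_i(X)]†` of the game's
Hessian, as a bilinear form. -/
def hessianBlock (i j : Fin N) (X : Profile G.M) (H : Herm (G.M i)) (K : Herm (G.M j)) : ℝ :=
  (1 / 2) * G.mixedDeriv j i j X H K + (1 / 2) * G.mixedDeriv i j i X K H

/-- `D(X) ≺ 0`: the block matrix `(D_{ij}(X))` is negative-definite. -/
def HessianNegDef (X : Profile G.M) : Prop :=
  ∀ H : Profile G.M, H ≠ 0 → ∑ i, ∑ j, G.hessianBlock i j X (H i) (H j) < 0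

/-- The exponential choice map `Y_i ↦ A_i exp(Y_i) / (1 + ‖exp(Y_i)‖)`. -/
def choice (Y : Profile G.M) : Profile G.M := fun i =>
  (G.A i / (1 + (Y i).exp.nuclearNorm)) • (Y i).exp

/-- The history of play up to stage `n`: the σ-algebra generated by `X(0), …, X(n)`, where
`X(k) = choice (Y(k))`. -/
@[reducible] def history {Ω : Type*} (Y : ℕ → Ω → Profile G.M) (n : ℕ) : MeasurableSpace Ω :=
  ⨆ k ≤ n, MeasurableSpace.comap (fun ω => G.choice (Y k ω)) (borel (Profile G.M))

/-- `Y` is the sequence of score matrices of a run of matrix exponential learning with step-sizes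
`γ` and gradient noise `Z`, started at an arbitrary (possibly random) Hermitian `Y(0)`; the noise
has zero mean and subexponential moment growth with constant `σ`, conditionally on the history.
The actions played are `X(n) = choice (Y(n))`. -/
structure IsMXLRun {Ω : Type*} [MeasurableSpace Ω] (P : Measure Ω) (γ : ℕ → ℝ) (σ : ℝ)
    (Y Z : ℕ → Ω → Profile G.M) : Prop where
  measurable_init : StronglyMeasurable (Y 0)
  measurable_noise : ∀ n, StronglyMeasurable (Z n)
  update : ∀ n ω, Y (n + 1) ω = Y n ω + γ n • (G.V (G.choice (Y n ω)) + Z n ω)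
  integrable_noise : ∀ n, ∀ p : ℕ, 1 ≤ p → Integrable (fun ω => ‖Z n ω‖ ^ p) P
  zero_mean : ∀ n, P[Z n | G.history Y n] =ᵐ[P] 0
  subexponential : ∀ n, ∀ p : ℕ, 1 ≤ p →
    P[fun ω => ‖Z n ω‖ ^ p | G.history Y n] ≤ᵐ[P] fun _ => (p.factorial : ℝ) / 2 * σ ^ p

end SemidefiniteGame

end

/-! MXL is dual averaging: `choice` is the gradient of the convex function `potential`, the sum of
the `A i * log (1 + tr exp Y_i)`, and the scores `Y` move along the payoff field plus noise. Put
W(n) = ∑_{k<n} γ_k Z(k). Then Y - W makes noiseless steps, with the field evaluated at the perturbed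
score Y. W is an L²-bounded martingale, so it converges almost surely. By Kolmogorov's inequality on
the time-zero event X(0) ∈ U, the event that W ever exceeds θ has conditional probability of order
σ² ∑ γ_n² / θ². What remains is deterministic: small, convergent perturbations W cannot prevent
convergence from a start near X* (`IsLocalDescent.tendsto`).

The Lyapunov function is Φ(Y) = f(Y) - ⟨X*, Y⟩, the Fenchel coupling up to a constant. It is convex
with gradient z = Q(Y) - X*, it is bounded below, and locally it decreases at rate at least c‖z‖² -
⟨z, V(X*)⟩. Here the Nash condition gives ⟨z, V(X*)⟩ ≤ 0, and D(X*) ≺ 0 gives strong monotonicity of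
V at X*. Since ∑ γ_n diverges, the play returns arbitrarily close to X* as long as it stays in the
local region (`exists_near`).

The difficulty is staying there. Closeness of Q(Y) to X* does not make Φ close to its infimum: at a
rank-deficient X*, a slight rotation of eigenvectors combined with a tiny eigenvalue makes the
relative entropy arbitrarily large, so sublevel sets of Φ contain no neighborhood of X*. The proof
of `IsLocalDescent.stay` uses gradients instead. A path escaping from scale r₀ to scale ρ = 2^N r₀
crosses N + 1 dyadic scales. By compactness, the rescaled gradients at two of these crossings nearly
coincide, so z_a ≈ l z_b with l ≤ 1/2. Let D be the displacement from a to b and Δ > 0 the drop of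
Φ. Convexity at a gives ⟨z_a, D⟩ ≤ -Δ and convexity at b gives ⟨z_b, D⟩ ≥ -Δ, up to small errors.
Hence -Δ ≳ -Δ/2, a contradiction (`no_parallel_gradients`). As N depends only on the dimension and
on the constants, the radius is uniform in the dual starting point.

Cocoercivity of the gradient of the free energy (`Herm.freeEnergy_cocoercive`) is a quantitative
Klein inequality, reduced to scalars by the doubly stochastic overlaps of two eigenbases. -/

/-! ### Lyapunov stability of perturbed dual averaging by a pigeonhole over scales -/

/-- Among sufficiently many points of a bounded set two are close. -/
theorem exists_close_pair {E : Type*} [NormedAddCommGroup E] [NormedSpace ℝ E]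
    [FiniteDimensional ℝ E] (B η : ℝ) (hη : 0 < η) :
    ∃ n : ℕ, ∀ x : ℕ → E, (∀ j ≤ n, ‖x j‖ ≤ B) → ∃ j k, j < k ∧ k ≤ n ∧ dist (x j) (x k) ≤ η := by
  have := FiniteDimensional.proper ℝ E
  have htb : TotallyBounded (Metric.closedBall (0 : E) B) :=
    (isCompact_closedBall (0 : E) B).totallyBounded
  obtain ⟨t, ht, hcover⟩ := Metric.totallyBounded_iff.1 htb (η / 2) (by positivity)
  lift t to Finset E using ht
  refine ⟨t.card, fun x hx => ?_⟩
  have h1 : ∀ j ∈ Finset.range (t.card + 1), ∃ y ∈ t, dist (x j) y < η / 2 := by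
    intro j hj
    have h2 := hcover (mem_closedBall_zero_iff.2 (hx j (by simpa [Nat.lt_succ_iff] using hj)))
    simpa using h2
  choose! c hc hd using h1
  obtain ⟨j, hj, k, hk, hjk, he⟩ := Finset.exists_ne_map_eq_of_card_lt_of_maps_to
    (s := Finset.range (t.card + 1)) (t := t) (by simp) hc
  have hclose : ∀ j ∈ Finset.range (t.card + 1), ∀ k ∈ Finset.range (t.card + 1), c j = c k →
      dist (x j) (x k) ≤ η := by
    intro j hj k hk he
    have h1 := hd j hj
    have h2 := hd k hk
    have h3 := dist_triangle_right (x j) (x k) (c j)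
    rw [he] at h3 h1
    linarith
  rcases lt_or_gt_of_ne hjk with h | h
  · exact ⟨j, k, h, by simpa [Nat.lt_succ_iff] using hk, hclose j hj k hk he⟩
  · exact ⟨k, j, h, by simpa [Nat.lt_succ_iff] using hj, hclose k hk j hj he.symm⟩

section descent

variable {E : Type*} [NormedAddCommGroup E] [NormedSpace ℝ E]

/-- Two points of a descent path of a convex function at which the (rescaled) gradients nearly
coincide cannot lie on different scales. -/
theorem no_parallel_gradients (p : E →L[ℝ] E →L[ℝ] ℝ) {Φ γ : ℕ → ℝ} {z U : ℕ → E} {v : E}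
    {a b : ℕ} (hab : a < b) {c C e μ η l : ℝ} (hc : 0 < c) (hc1 : c ≤ 1) (hC : 0 ≤ C) (hμ : 0 < μ)
    (hη : 0 ≤ η) (hl0 : 0 ≤ l) (hl : l ≤ 1 / 2) (he0 : 0 ≤ e) (he : e ≤ c * μ ^ 2 / 16)
    (hηc : η * (1 + ‖p‖ * C) ≤ c / 8) (hγ : ∀ i, 0 < γ i)
    (hdesc : ∀ i ∈ Finset.Ico a b, Φ (i + 1) ≤ Φ i + γ i * (p (z i) (v + U i) + e))
    (hca : Φ a + p (z a) (∑ i ∈ Finset.Ico a b, γ i • (v + U i)) -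
      e * ∑ i ∈ Finset.Ico a b, γ i ≤ Φ b)
    (hcb : Φ b - p (z b) (∑ i ∈ Finset.Ico a b, γ i • (v + U i)) -
      e * ∑ i ∈ Finset.Ico a b, γ i ≤ Φ a)
    (hv : ∀ i, p (z i) v ≤ 0)
    (hU : ∀ i ∈ Finset.Ico a b, p (z i) (U i) ≤ -c * ‖z i‖ ^ 2)
    (hUC : ∀ i ∈ Finset.Ico a b, ‖U i‖ ≤ C * ‖z i‖)
    (hq : ∀ i ∈ Finset.Ico a b, μ ^ 2 ≤ ‖z i‖ ^ 2 - p (z i) v)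
    (hz : ‖z a - l • z b‖ ≤ η * μ) (hn : l * p (z b) v - p (z a) v ≤ η * μ ^ 2) : False := by
  set S := ∑ i ∈ Finset.Ico a b, γ i * (‖z i‖ ^ 2 - p (z i) v) with hS
  set τ := ∑ i ∈ Finset.Ico a b, γ i with hτ
  set G := ∑ i ∈ Finset.Ico a b, γ i • U i with hG
  have hne : (Finset.Ico a b).Nonempty := Finset.nonempty_Ico.2 hab
  have hτ0 : 0 < τ := Finset.sum_pos (fun i _ => hγ i) hne
  -- The path stays above scale μ, so the elapsed time τ is paid for by the dissipation S; this
  -- absorbs every error proportional to τ.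
  have hτS : τ * μ ^ 2 ≤ S := by
    rw [hτ, hS, Finset.sum_mul]
    exact Finset.sum_le_sum fun i hi => mul_le_mul_of_nonneg_left (hq i hi) (hγ i).le
  have hSpos : 0 < S := lt_of_lt_of_le (by positivity) hτS
  have heτ : e * τ ≤ c * S / 16 := by
    have h1 := mul_le_mul_of_nonneg_right he hτ0.le
    have h2 := mul_le_mul_of_nonneg_left hτS hc.le
    linarith
  have hsum : ∑ i ∈ Finset.Ico a b, γ i • (v + U i) = τ • v + G := by
    simp only [smul_add, Finset.sum_add_distrib, hτ, hG, Finset.sum_smul]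
  have htel : Φ b - Φ a ≤ -c * S + e * τ := by
    rw [← Finset.sum_Ico_sub Φ hab.le, hS, hτ, Finset.mul_sum, Finset.mul_sum,
      ← Finset.sum_add_distrib]
    refine Finset.sum_le_sum fun i hi => ?_
    have h1 := hdesc i hi
    have h2 := hU i hi
    have h3 := hv i
    have h4 : p (z i) (v + U i) + e ≤ -c * (‖z i‖ ^ 2 - p (z i) v) + e := by
      rw [map_add]
      have h6 := mul_le_mul_of_nonneg_right hc1 (neg_nonneg.2 h3)
      linarith
    have h5 := mul_le_mul_of_nonneg_left h4 (hγ i).le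
    linarith
  have hGS : μ * ‖G‖ ≤ C * S := by
    have h1 : ‖G‖ ≤ ∑ i ∈ Finset.Ico a b, γ i * (C * ‖z i‖) := by
      refine (norm_sum_le _ _).trans (Finset.sum_le_sum fun i hi => ?_)
      rw [norm_smul, Real.norm_of_nonneg (hγ i).le]
      exact mul_le_mul_of_nonneg_left (hUC i hi) (hγ i).le
    refine (mul_le_mul_of_nonneg_left h1 hμ.le).trans ?_
    rw [hS, Finset.mul_sum, Finset.mul_sum]
    refine Finset.sum_le_sum fun i hi => ?_
    -- If ‖z‖ ≤ μ, compare with the lower bound μ² on the right-hand side; otherwise compare with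
    -- ‖z‖². Thus the non-constant part G of the displacement is controlled by S/μ.
    have h2 : μ * ‖z i‖ ≤ ‖z i‖ ^ 2 - p (z i) v := by
      have h3 := hq i hi
      have h4 := hv i
      have h5 := norm_nonneg (z i)
      rcases le_total ‖z i‖ μ with h | h
      · have := mul_le_mul_of_nonneg_left h hμ.le
        linarith [sq μ]
      · have := mul_le_mul_of_nonneg_right h h5
        linarith [sq ‖z i‖]
    have := mul_le_mul_of_nonneg_left h2 (mul_nonneg hC (hγ i).le)
    linarith
  rw [hsum] at hca hcb
  simp only [map_add, map_smul, smul_eq_mul] at hca hcb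
  have hpz : -(p (z a - l • z b) G) ≤ ‖p‖ * η * C * S := by
    have h1 : -(p (z a - l • z b) G) ≤ ‖p‖ * ‖z a - l • z b‖ * ‖G‖ :=
      (neg_le_abs _).trans (p.le_opNorm₂ _ _)
    have h2 : ‖p‖ * ‖z a - l • z b‖ * ‖G‖ ≤ ‖p‖ * (η * μ) * ‖G‖ := by gcongr
    have h3 : ‖p‖ * η * (μ * ‖G‖) ≤ ‖p‖ * η * (C * S) :=
      mul_le_mul_of_nonneg_left hGS (by positivity)
    linarith
  have hpz' : p (z a - l • z b) G = p (z a) G - l * p (z b) G := by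
    simp
  rw [hpz'] at hpz
  have hnτ : τ * (l * p (z b) v - p (z a) v) ≤ η * S := by
    have h1 := mul_le_mul_of_nonneg_left hn hτ0.le
    have h2 := mul_le_mul_of_nonneg_left hτS hη
    linarith
  have hηS : η * (1 + ‖p‖ * C) * S ≤ c / 8 * S := mul_le_mul_of_nonneg_right hηc hSpos.le
  -- Scale convexity at b by l and compare it with convexity at a. With Δ = Φ a - Φ b, the errors
  -- leave Δ/2 ≤ (3/32 + 4/32) c S, whereas the descent gives Δ ≥ (15/16) c S.
  have hcb' := mul_le_mul_of_nonneg_left hcb hl0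
  have hcS : 0 < c * S := mul_pos hc hSpos
  have hD : 0 ≤ Φ a - Φ b := by linarith
  have hlD : l * (Φ a - Φ b) ≤ 1 / 2 * (Φ a - Φ b) := mul_le_mul_of_nonneg_right hl hD
  have hle : l * (e * τ) ≤ 1 / 2 * (e * τ) := mul_le_mul_of_nonneg_right hl (by positivity)
  linarith

end descent

/-- The data of dual averaging `Y ↦ Q Y` along a vector field `V`: `Q` is the gradient (with respect
to the pairing `p`) of a convex function `f` with co-coercive gradient, and `x` is a solution of the
variational inequality of `V` near which `V` is strongly monotone (decreasing) and Lipschitz. -/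
structure IsLocalDescent {E : Type*} [NormedAddCommGroup E] [NormedSpace ℝ E]
    (p : E →L[ℝ] E →L[ℝ] ℝ) (f : E → ℝ) (Q V : E → E) (x : E) (κ c C R : ℝ) : Prop where
  κ_pos : 0 < κ
  c_pos : 0 < c
  c_le_one : c ≤ 1
  C_nonneg : 0 ≤ C
  R_pos : 0 < R
  cocoercive : ∀ Y Y', f Y + p (Q Y) (Y' - Y) + κ * ‖Q Y' - Q Y‖ ^ 2 ≤ f Y'
  lower : ∀ Y, p x Y ≤ f Y
  vi : ∀ Y, p (Q Y - x) (V x) ≤ 0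
  monotone : ∀ Y, ‖Q Y - x‖ ≤ R → p (Q Y - x) (V (Q Y) - V x) ≤ -c * ‖Q Y - x‖ ^ 2
  lipschitz_at : ∀ Y, ‖Q Y - x‖ ≤ R → ‖V (Q Y) - V x‖ ≤ C * ‖Q Y - x‖

namespace IsLocalDescent

variable {E : Type*} [NormedAddCommGroup E] [NormedSpace ℝ E]
  {p : E →L[ℝ] E →L[ℝ] ℝ} {f : E → ℝ} {Q V : E → E} {x : E} {κ c C R : ℝ}

/-- Adding the two cocoercivity inequalities for (Y, Y') and (Y', Y) cancels f and leaves 2κ‖Q Y' -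
Q Y‖² ≤ ⟨Q Y' - Q Y, Y' - Y⟩. -/
theorem norm_Q_sub_le (h : IsLocalDescent p f Q V x κ c C R) (Y Y' : E) :
    ‖Q Y' - Q Y‖ ≤ ‖p‖ / (2 * κ) * ‖Y' - Y‖ := by
  have h1 := h.cocoercive Y Y'
  have h2 := h.cocoercive Y' Y
  have h3 : p (Q Y) (Y' - Y) + p (Q Y') (Y - Y') = -(p (Q Y' - Q Y) (Y' - Y)) := by
    simp only [map_sub, sub_apply]; ring
  have h4 : p (Q Y' - Q Y) (Y' - Y) ≤ ‖p‖ * ‖Q Y' - Q Y‖ * ‖Y' - Y‖ :=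
    (le_abs_self _).trans (p.le_opNorm₂ _ _)
  rw [norm_sub_rev (Q Y) (Q Y')] at h2
  have hκ := h.κ_pos
  rw [div_mul_eq_mul_div, le_div_iff₀ (by positivity)]
  rcases (norm_nonneg (Q Y' - Q Y)).eq_or_lt with h0 | h0
  · rw [← h0]; simp; positivity
  · refine le_of_mul_le_mul_left ?_ h0
    nlinarith

theorem le_add_smooth (h : IsLocalDescent p f Q V x κ c C R) (Y Y' : E) :
    f Y' ≤ f Y + p (Q Y) (Y' - Y) + ‖p‖ * (‖p‖ / (2 * κ)) * ‖Y' - Y‖ ^ 2 := by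
  have h2 := h.cocoercive Y' Y
  have h3 : p (Q Y) (Y' - Y) + p (Q Y') (Y - Y') = -(p (Q Y' - Q Y) (Y' - Y)) := by
    simp only [map_sub, sub_apply]; ring
  have h4 : p (Q Y' - Q Y) (Y' - Y) ≤ ‖p‖ * ‖Q Y' - Q Y‖ * ‖Y' - Y‖ :=
    (le_abs_self _).trans (p.le_opNorm₂ _ _)
  have h5 : ‖p‖ * ‖Q Y' - Q Y‖ * ‖Y' - Y‖ ≤ ‖p‖ * (‖p‖ / (2 * κ) * ‖Y' - Y‖) * ‖Y' - Y‖ := by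
    gcongr; exact h.norm_Q_sub_le Y Y'
  have h6 := mul_nonneg h.κ_pos.le (sq_nonneg ‖Q Y - Q Y'‖)
  have h7 : ‖p‖ * (‖p‖ / (2 * κ) * ‖Y' - Y‖) * ‖Y' - Y‖ =
    ‖p‖ * (‖p‖ / (2 * κ)) * ‖Y' - Y‖ ^ 2 := by ring
  linarith

theorem norm_V_le (h : IsLocalDescent p f Q V x κ c C R) {Y : E} (hY : ‖Q Y - x‖ ≤ R) :
    ‖V (Q Y)‖ ≤ ‖V x‖ + C * R := by
  have h1 := h.lipschitz_at Y hY
  have h2 : C * ‖Q Y - x‖ ≤ C * R := mul_le_mul_of_nonneg_left hY h.C_nonneg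
  have h3 := norm_le_norm_add_norm_sub' (V (Q Y)) (V x)
  linarith

/-- The function f - p x is evaluated at the noiseless score Y - W, while its gradient is read off
at Y. As Q is Lipschitz, this mismatch costs O(θ) per unit of step, as does the second-order term of
a step because γ ≤ θ. One constant K serves the descent inequality, convexity from either end of a
path, and the size of a single jump. -/
theorem exists_errors (h : IsLocalDescent p f Q V x κ c C R) :
    ∃ K : ℝ, 0 < K ∧ ∀ (θ : ℝ), 0 ≤ θ → ∀ (Y W : ℕ → E) (γ : ℕ → ℝ), (∀ n, 0 < γ n) →
      (∀ n, γ n ≤ θ) → (∀ n, ‖W n‖ ≤ θ) →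
      (∀ n, Y (n + 1) - W (n + 1) = Y n - W n + γ n • V (Q (Y n))) →
      (∀ i, ‖Q (Y i) - x‖ ≤ R → f (Y (i + 1) - W (i + 1)) - p x (Y (i + 1) - W (i + 1)) ≤
        f (Y i - W i) - p x (Y i - W i) + γ i * (p (Q (Y i) - x) (V (Q (Y i))) + K * θ)) ∧
      (∀ a b, a ≤ b → (∀ i ∈ Finset.Ico a b, ‖Q (Y i) - x‖ ≤ R) →
        f (Y a - W a) - p x (Y a - W a) +
          p (Q (Y a) - x) (∑ i ∈ Finset.Ico a b, γ i • V (Q (Y i))) -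
          K * θ * ∑ i ∈ Finset.Ico a b, γ i ≤ f (Y b - W b) - p x (Y b - W b) ∧
        f (Y b - W b) - p x (Y b - W b) -
          p (Q (Y b) - x) (∑ i ∈ Finset.Ico a b, γ i • V (Q (Y i))) -
          K * θ * ∑ i ∈ Finset.Ico a b, γ i ≤ f (Y a - W a) - p x (Y a - W a)) ∧
      (∀ i, ‖Q (Y i) - x‖ ≤ R → ‖Q (Y (i + 1)) - Q (Y i)‖ ≤ K * θ) := by
  set B := ‖V x‖ + C * R with hB
  set L := ‖p‖ / (2 * κ) with hL
  have hκ := h.κ_pos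
  have hR := h.R_pos
  have hC := h.C_nonneg
  have hB0 : 0 ≤ B := by positivity
  have hL0 : 0 ≤ L := by positivity
  have hK1 : ‖p‖ * L * B * (1 + B) ≤ ‖p‖ * L * B * (1 + B) + L * (B + 2) + 1 := by
    have : 0 ≤ L * (B + 2) := by positivity
    linarith
  have hK2 : L * (B + 2) ≤ ‖p‖ * L * B * (1 + B) + L * (B + 2) + 1 := by
    have : 0 ≤ ‖p‖ * L * B * (1 + B) := by positivity
    linarith
  have hK3 : ‖p‖ * L * B ≤ ‖p‖ * L * B * (1 + B) + L * (B + 2) + 1 := by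
    refine le_trans ?_ hK1
    exact le_mul_of_one_le_right (by positivity) (by linarith)
  refine ⟨‖p‖ * L * B * (1 + B) + L * (B + 2) + 1, by positivity, ?_⟩
  set K := ‖p‖ * L * B * (1 + B) + L * (B + 2) + 1
  intro θ hθ Y W γ hγ hγθ hW hrun
  have hQW : ∀ n, ‖Q (Y n - W n) - Q (Y n)‖ ≤ L * θ := by
    intro n
    refine (h.norm_Q_sub_le _ _).trans (mul_le_mul_of_nonneg_left ?_ hL0)
    simpa using hW n
  have hpert : ∀ n (D : E), |p (Q (Y n - W n) - Q (Y n)) D| ≤ ‖p‖ * (L * θ) * ‖D‖ := by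
    intro n D
    refine (p.le_opNorm₂ _ _).trans ?_
    have := hQW n
    gcongr
  refine ⟨fun i hi => ?_, fun a b hab hi => ?_, fun i hi => ?_⟩
  · have hVB := h.norm_V_le hi
    have h1 := h.le_add_smooth (Y i - W i) (Y (i + 1) - W (i + 1))
    have h2 : Y (i + 1) - W (i + 1) - (Y i - W i) = γ i • V (Q (Y i)) := by rw [hrun]; abel
    have h3 := (abs_le.1 (hpert i (V (Q (Y i))))).2
    rw [h2, norm_smul, Real.norm_of_nonneg (hγ i).le, map_smul, smul_eq_mul, ← hL] at h1
    have h4 : p x (Y (i + 1) - W (i + 1)) = p x (Y i - W i) + γ i * p x (V (Q (Y i))) := by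
      rw [hrun, map_add, map_smul, smul_eq_mul]
    have h5 : p (Q (Y i - W i) - Q (Y i)) (V (Q (Y i))) ≤ ‖p‖ * L * B * θ := by
      refine h3.trans ?_
      calc ‖p‖ * (L * θ) * ‖V (Q (Y i))‖ ≤ ‖p‖ * (L * θ) * B := by gcongr
        _ = _ := by ring
    have h6 : ‖p‖ * L * (γ i * ‖V (Q (Y i))‖) ^ 2 ≤ γ i * (‖p‖ * L * B * B * θ) := by
      calc ‖p‖ * L * (γ i * ‖V (Q (Y i))‖) ^ 2
          = γ i * (‖p‖ * L * ‖V (Q (Y i))‖ * ‖V (Q (Y i))‖ * γ i) := by ring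
        _ ≤ γ i * (‖p‖ * L * B * B * θ) := by
          have := hγ i
          have := hγθ i
          gcongr
    have h7 : ‖p‖ * L * B * θ + ‖p‖ * L * B * B * θ ≤ K * θ := by
      have := mul_le_mul_of_nonneg_right hK1 hθ
      linarith
    have h8 : p (Q (Y i - W i)) (V (Q (Y i))) = p (Q (Y i - W i) - Q (Y i)) (V (Q (Y i))) +
      p (Q (Y i) - x) (V (Q (Y i))) + p x (V (Q (Y i))) := by
      simp only [map_sub, sub_apply]; ring
    have h9 : γ i * (p (Q (Y i - W i)) (V (Q (Y i))) - p x (V (Q (Y i))) + ‖p‖ * L * B * B * θ) ≤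
      γ i * (p (Q (Y i) - x) (V (Q (Y i))) + K * θ) :=
      mul_le_mul_of_nonneg_left (by linarith) (hγ i).le
    linarith
  · have hdiff : Y b - W b - (Y a - W a) = ∑ i ∈ Finset.Ico a b, γ i • V (Q (Y i)) := by
      rw [← Finset.sum_Ico_sub (fun i => Y i - W i) hab]
      refine Finset.sum_congr rfl fun i _ => ?_
      rw [hrun]; abel
    set D := ∑ i ∈ Finset.Ico a b, γ i • V (Q (Y i)) with hD
    have hDn : ‖D‖ ≤ B * ∑ i ∈ Finset.Ico a b, γ i := by
      rw [Finset.mul_sum]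
      refine (norm_sum_le _ _).trans (Finset.sum_le_sum fun i hi' => ?_)
      rw [norm_smul, Real.norm_of_nonneg (hγ i).le, mul_comm]
      exact mul_le_mul_of_nonneg_right (h.norm_V_le (hi i hi')) (hγ i).le
    have hτ : 0 ≤ ∑ i ∈ Finset.Ico a b, γ i := Finset.sum_nonneg fun i _ => (hγ i).le
    have hbound : ‖p‖ * (L * θ) * ‖D‖ ≤ K * θ * ∑ i ∈ Finset.Ico a b, γ i := by
      calc ‖p‖ * (L * θ) * ‖D‖ ≤ ‖p‖ * (L * θ) * (B * ∑ i ∈ Finset.Ico a b, γ i) := by gcongr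
        _ = (‖p‖ * L * B) * (θ * ∑ i ∈ Finset.Ico a b, γ i) := by ring
        _ ≤ K * (θ * ∑ i ∈ Finset.Ico a b, γ i) := by gcongr
        _ = _ := by ring
    have hdiff' : Y a - W a - (Y b - W b) = -D := by rw [← hdiff]; abel
    have hpx : p x (Y b - W b) = p x (Y a - W a) + p x D := by
      rw [← hdiff, ← map_add]; congr 1; abel
    have hk := h.κ_pos
    have hsplit : ∀ n, p (Q (Y n - W n)) D = p (Q (Y n - W n) - Q (Y n)) D +
      p (Q (Y n) - x) D + p x D := by
      intro n; simp only [map_sub, sub_apply]; ring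
    constructor
    · have h1 := h.cocoercive (Y a - W a) (Y b - W b)
      rw [hdiff, hsplit] at h1
      have h2 := (abs_le.1 (hpert a D)).1
      have h3 : 0 ≤ κ * ‖Q (Y b - W b) - Q (Y a - W a)‖ ^ 2 := by positivity
      linarith
    · have h1 := h.cocoercive (Y b - W b) (Y a - W a)
      rw [hdiff', map_neg, hsplit] at h1
      have h2 := (abs_le.1 (hpert b D)).2
      have h3 : 0 ≤ κ * ‖Q (Y a - W a) - Q (Y b - W b)‖ ^ 2 := by positivity
      linarith
  · have h1 : Y (i + 1) - Y i = γ i • V (Q (Y i)) + (W (i + 1) - W i) := by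
      have : Y (i + 1) = (Y (i + 1) - W (i + 1)) + W (i + 1) := by abel
      rw [this, hrun]; abel
    have h2 : ‖Y (i + 1) - Y i‖ ≤ (B + 2) * θ := by
      rw [h1]
      refine (norm_add_le _ _).trans ?_
      have h3 : ‖γ i • V (Q (Y i))‖ ≤ θ * B := by
        rw [norm_smul, Real.norm_of_nonneg (hγ i).le]
        have := hγθ i
        have := h.norm_V_le hi
        gcongr
      have h4 := norm_sub_le (W (i + 1)) (W i)
      linarith [hW i, hW (i + 1)]
    refine (h.norm_Q_sub_le _ _).trans ?_
    calc L * ‖Y (i + 1) - Y i‖ ≤ L * ((B + 2) * θ) := by gcongr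
      _ = L * (B + 2) * θ := by ring
      _ ≤ K * θ := by gcongr

end IsLocalDescent

/-- Last passage: a sequence that starts below a level and ends above it. -/
theorem exists_last_le {q : ℕ → ℝ} {T : ℕ} {B : ℝ} (h0 : q 0 ≤ B) (hT : B < q T) :
    ∃ s < T, q s ≤ B ∧ ∀ i, s < i → i ≤ T → B < q i := by
  classical
  have hs : q (Nat.findGreatest (fun i => q i ≤ B) T) ≤ B :=
    Nat.findGreatest_spec (P := fun i => q i ≤ B) (Nat.zero_le T) h0
  refine ⟨_, lt_of_le_of_ne (Nat.findGreatest_le T) fun he => ?_, hs, fun i h1 h2 => ?_⟩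
  · rw [he] at hs; linarith
  · exact not_le.1 (Nat.findGreatest_is_greatest h1 h2)

namespace IsLocalDescent

variable {E : Type*} [NormedAddCommGroup E] [NormedSpace ℝ E] [FiniteDimensional ℝ E]
  {p : E →L[ℝ] E →L[ℝ] ℝ} {f : E → ℝ} {Q V : E → E} {x : E} {κ c C R : ℝ}

/-- Lyapunov stability of `x` in the primal variable, uniformly in the dual starting point and
robustly with respect to perturbations `W`. -/
theorem stay (h : IsLocalDescent p f Q V x κ c C R) {ρ : ℝ} (hρ : 0 < ρ) (hρR : ρ ≤ R) :
    ∃ r > 0, ∃ θ > 0, ∀ (Y W : ℕ → E) (γ : ℕ → ℝ), (∀ n, 0 < γ n) →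
      (∀ n, γ n ≤ θ) → (∀ n, ‖W n‖ ≤ θ) →
      (∀ n, Y (n + 1) - W (n + 1) = Y n - W n + γ n • V (Q (Y n))) →
      ‖Q (Y 0) - x‖ < r → ∀ n, ‖Q (Y n) - x‖ ≤ ρ := by
  obtain ⟨K, hK, herr⟩ := h.exists_errors
  have hc := h.c_pos
  have hC := h.C_nonneg
  set η := c / 8 / (1 + ‖p‖ * C) with hη
  have hη0 : 0 < η := by positivity
  -- Pigeonhole in E × ℝ: the real coordinate tracks -p z (V x), which scales quadratically while z
  -- scales linearly.
  obtain ⟨N, hN⟩ := exists_close_pair (E := E × ℝ) 2 η hη0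
  set r₀ := ρ / 2 ^ N with hr₀
  have hr₀0 : 0 < r₀ := by positivity
  set A := 2 * ρ + K + ‖p‖ * ‖V x‖ with hA
  have hA0 : 0 < A := by positivity
  -- The radius gives q 0 ≤ r₀² for the gauge q = ‖z‖² - p z (V x). The bounds on θ make the error K
  -- θ at most c r₀²/16 and limit the growth of q in one step to r₀²; A collects the coefficients of
  -- that growth.
  refine ⟨min 1 (r₀ ^ 2 / (1 + ‖p‖ * ‖V x‖)), by positivity,
    min 1 (min (c * r₀ ^ 2 / 16 / K) (r₀ ^ 2 / (K * A))), by positivity, ?_⟩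
  set θ := min 1 (min (c * r₀ ^ 2 / 16 / K) (r₀ ^ 2 / (K * A))) with hθ
  have hθ0 : 0 < θ := by positivity
  have hθ1 : θ ≤ 1 := min_le_left _ _
  have hθ2 : K * θ ≤ c * r₀ ^ 2 / 16 := by
    have : θ ≤ c * r₀ ^ 2 / 16 / K := (min_le_right _ _).trans (min_le_left _ _)
    rwa [le_div_iff₀ hK, mul_comm] at this
  have hθ3 : K * θ * A ≤ r₀ ^ 2 := by
    have : θ ≤ r₀ ^ 2 / (K * A) := (min_le_right _ _).trans (min_le_right _ _)
    rw [le_div_iff₀ (by positivity)] at this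
    linarith
  intro Y W γ hγ hγθ hW hrun hstart
  obtain ⟨hstep, hconv, hjump⟩ := herr θ hθ0.le Y W γ hγ hγθ hW hrun
  set z : ℕ → E := fun i => Q (Y i) - x with hz
  set q : ℕ → ℝ := fun i => ‖z i‖ ^ 2 - p (z i) (V x) with hq
  have hv : ∀ i, p (z i) (V x) ≤ 0 := fun i => h.vi (Y i)
  have hzq : ∀ i, ‖z i‖ ^ 2 ≤ q i := fun i => by simp only [hq]; linarith [hv i]
  have hnq : ∀ i, -p (z i) (V x) ≤ q i := fun i => by
    simp only [hq]; linarith [sq_nonneg ‖z i‖]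
  have hsmall : ∀ i, q i ≤ ρ ^ 2 → ‖z i‖ ≤ ρ := fun i hi =>
    le_of_sq_le_sq ((hzq i).trans hi) hρ.le
  have hq0 : q 0 ≤ r₀ ^ 2 := by
    have h1 : ‖z 0‖ ≤ 1 := (hstart.trans_le (min_le_left _ _)).le
    have h2 : ‖z 0‖ ≤ r₀ ^ 2 / (1 + ‖p‖ * ‖V x‖) := (hstart.trans_le (min_le_right _ _)).le
    rw [le_div_iff₀ (by positivity)] at h2
    have h3 : -p (z 0) (V x) ≤ ‖p‖ * ‖z 0‖ * ‖V x‖ := (neg_le_abs _).trans (p.le_opNorm₂ _ _)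
    have h4 : ‖z 0‖ ^ 2 ≤ ‖z 0‖ := by
      rw [sq]; exact mul_le_of_le_one_left (norm_nonneg _) h1
    simp only [hq]
    linarith
  have hqjump : ∀ i, q i ≤ ρ ^ 2 → q (i + 1) ≤ q i + r₀ ^ 2 := by
    intro i hi
    have hzi := hsmall i hi
    have h1 : ‖z (i + 1) - z i‖ ≤ K * θ := by
      have := hjump i (hzi.trans hρR)
      simpa [hz] using this
    have h2 : ‖z (i + 1)‖ ≤ ‖z i‖ + K * θ :=
      (norm_le_norm_add_norm_sub' _ (z i)).trans (by linarith)
    have h3 : ‖z (i + 1)‖ ^ 2 ≤ (‖z i‖ + K * θ) ^ 2 :=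
      pow_le_pow_left₀ (norm_nonneg _) h2 2
    have h4 : -p (z (i + 1) - z i) (V x) ≤ ‖p‖ * (K * θ) * ‖V x‖ := by
      refine (neg_le_abs _).trans ((p.le_opNorm₂ _ _).trans ?_)
      gcongr
    have h5 : p (z (i + 1) - z i) (V x) = p (z (i + 1)) (V x) - p (z i) (V x) := by
      simp only [map_sub, sub_apply]
    have h6 : K * θ * ‖z i‖ ≤ K * θ * ρ := mul_le_mul_of_nonneg_left hzi (by positivity)
    have h7 : K * θ * (K * θ) ≤ K * θ * K :=
      mul_le_mul_of_nonneg_left (mul_le_of_le_one_right hK.le hθ1) (by positivity)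
    rw [h5] at h4
    have h8 : K * θ * A = 2 * (K * θ * ρ) + K * θ * K + ‖p‖ * (K * θ) * ‖V x‖ := by
      rw [hA]; ring
    simp only [hq]
    linarith
  suffices hmain : ∀ n, q n ≤ ρ ^ 2 from fun n => hsmall n (hmain n)
  by_contra hcon
  push Not at hcon
  classical
  set T := Nat.find hcon with hT
  have hqT : ρ ^ 2 < q T := Nat.find_spec hcon
  have hqlt : ∀ i < T, q i ≤ ρ ^ 2 := fun i hi => not_lt.1 (Nat.find_min hcon hi)
  set μ : ℕ → ℝ := fun j => 2 ^ j * r₀ with hμ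
  have hμ0 : ∀ j, 0 < μ j := fun j => by positivity
  have hμr : ∀ j, r₀ ≤ μ j := fun j =>
    le_mul_of_one_le_left hr₀0.le (one_le_pow₀ (by norm_num))
  have hμρ : ∀ j ≤ N, μ j ≤ ρ := by
    intro j hj
    have h1 : ρ = 2 ^ N * r₀ := by rw [hr₀]; field_simp
    rw [h1]
    exact mul_le_mul_of_nonneg_right (pow_le_pow_right₀ (by norm_num) hj) hr₀0.le
  -- T is the first exit above ρ². Taking the last passage below each level μ j ^ 2 before T keeps q
  -- above that level from then until T, which supplies the lower bound μ on the whole stretch.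
  have hlast : ∀ j, ∃ s, j ≤ N → s < T ∧ q s ≤ μ j ^ 2 ∧ ∀ i, s < i → i ≤ T → μ j ^ 2 < q i := by
    intro j
    by_cases hj : j ≤ N
    · have h1 : q 0 ≤ μ j ^ 2 := hq0.trans (pow_le_pow_left₀ hr₀0.le (hμr j) 2)
      have h2 : μ j ^ 2 < q T := lt_of_le_of_lt (pow_le_pow_left₀ (hμ0 j).le (hμρ j hj) 2) hqT
      obtain ⟨s, h3, h4, h5⟩ := exists_last_le h1 h2
      exact ⟨s, fun _ => ⟨h3, h4, h5⟩⟩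
    · exact ⟨0, fun h => absurd h hj⟩
  choose s hs using hlast
  have hqt : ∀ j ≤ N, q (s j + 1) ≤ 2 * μ j ^ 2 := by
    intro j hj
    obtain ⟨h1, h2, -⟩ := hs j hj
    have h3 := hqjump (s j) (hqlt _ h1)
    have h4 : r₀ ^ 2 ≤ μ j ^ 2 := pow_le_pow_left₀ hr₀0.le (hμr j) 2
    linarith
  obtain ⟨j, k, hjk, hkN, hdist⟩ := hN
    (fun j => ((μ j)⁻¹ • z (s j + 1), ((μ j) ^ 2)⁻¹ * -p (z (s j + 1)) (V x))) (by
      intro j hj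
      have h1 := hqt j hj
      have h2 := hμ0 j
      refine max_le ?_ ?_
      · show ‖(μ j)⁻¹ • z (s j + 1)‖ ≤ 2
        rw [norm_smul, norm_inv, Real.norm_of_nonneg h2.le, inv_mul_le_iff₀ h2]
        refine le_of_sq_le_sq ((hzq _).trans ?_) (by positivity)
        nlinarith [sq_nonneg (μ j)]
      · show ‖((μ j) ^ 2)⁻¹ * -p (z (s j + 1)) (V x)‖ ≤ 2
        rw [Real.norm_of_nonneg (mul_nonneg (by positivity) (neg_nonneg.2 (hv _))),
          inv_mul_le_iff₀ (by positivity)]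
        linarith [hnq (s j + 1)])
  have hjN : j ≤ N := hjk.le.trans hkN
  obtain ⟨hsj1, hsj2, hsj3⟩ := hs j hjN
  obtain ⟨hsk1, hsk2, hsk3⟩ := hs k hkN
  have h2μ : 2 * μ j ≤ μ k := by
    have : (2 : ℝ) ^ (j + 1) ≤ 2 ^ k := pow_le_pow_right₀ (by norm_num) hjk
    have := mul_le_mul_of_nonneg_right this hr₀0.le
    simp only [hμ]; rw [pow_succ] at this; linarith
  -- Just after leaving level j one has q ≤ 2 μ_j² < 4 μ_j² ≤ μ_k², so the last passage below level
  -- k comes strictly later.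
  have hlt : s j + 1 < s k + 1 := by
    by_contra hle
    have h1 := hsk3 (s j + 1) (by omega) hsj1
    have h2 := hqt j hjN
    have h3 : (2 * μ j) ^ 2 ≤ μ k ^ 2 := pow_le_pow_left₀ (by have := hμ0 j; positivity) h2μ 2
    nlinarith [hμ0 j]
  have hIco : ∀ i ∈ Finset.Ico (s j + 1) (s k + 1), i < T := by
    intro i hi; rw [Finset.mem_Ico] at hi; omega
  have hzR : ∀ i ∈ Finset.Ico (s j + 1) (s k + 1), ‖Q (Y i) - x‖ ≤ R := fun i hi =>
    (hsmall i (hqlt i (hIco i hi))).trans hρR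
  obtain ⟨hca, hcb⟩ := hconv (s j + 1) (s k + 1) hlt.le hzR
  have hd1 : ‖(μ j)⁻¹ • z (s j + 1) - (μ k)⁻¹ • z (s k + 1)‖ ≤ η := by
    rw [← dist_eq_norm]; exact (le_max_left _ _).trans hdist
  have hd2 : ((μ j) ^ 2)⁻¹ * -p (z (s j + 1)) (V x) - ((μ k) ^ 2)⁻¹ * -p (z (s k + 1)) (V x) ≤ η :=
    (le_abs_self _).trans ((le_max_right _ _).trans hdist)
  have hμj := hμ0 j
  have hμk := hμ0 k
  refine no_parallel_gradients p (Φ := fun i => f (Y i - W i) - p x (Y i - W i)) (γ := γ)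
    (z := z) (U := fun i => V (Q (Y i)) - V x) (v := V x) hlt (e := K * θ) (μ := μ j) (η := η)
    (l := μ j / μ k) hc h.c_le_one hC hμj hη0.le (by positivity) ?_ (by positivity) ?_ ?_ hγ
    ?_ ?_ ?_ hv ?_ ?_ ?_ ?_ ?_
  · rw [div_le_iff₀ hμk]; linarith
  · refine hθ2.trans ?_
    have := pow_le_pow_left₀ hr₀0.le (hμr j) 2
    gcongr
  · rw [hη, div_mul_cancel₀]; positivity
  · intro i hi
    simpa only [add_sub_cancel] using hstep i (hzR i hi)
  · simpa only [add_sub_cancel] using hca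
  · simpa only [add_sub_cancel] using hcb
  · intro i hi
    exact h.monotone (Y i) (hzR i hi)
  · intro i hi
    exact h.lipschitz_at (Y i) (hzR i hi)
  · intro i hi
    exact (hsj3 i (by rw [Finset.mem_Ico] at hi; omega) (hIco i hi).le).le
  · have h1 : ∀ u w : E, u - (μ j / μ k) • w = μ j • ((μ j)⁻¹ • u - (μ k)⁻¹ • w) := by
      intro u w
      rw [smul_sub, smul_smul, smul_smul, mul_inv_cancel₀ hμj.ne', one_smul, div_eq_mul_inv]
    rw [h1, norm_smul, Real.norm_of_nonneg hμj.le, mul_comm]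
    exact mul_le_mul_of_nonneg_right hd1 hμj.le
  · set a := -p (z (s j + 1)) (V x) with ha
    set b := -p (z (s k + 1)) (V x) with hb
    have hb0 : 0 ≤ b := neg_nonneg.2 (hv _)
    have h1 := mul_le_mul_of_nonneg_left hd2 (sq_nonneg (μ j))
    have h2 : μ j ^ 2 * ((μ j ^ 2)⁻¹ * a - (μ k ^ 2)⁻¹ * b) = a - (μ j / μ k) ^ 2 * b := by
      field_simp
    -- The second coordinates match with ratio l², not l; since l ≤ 1 and b ≥ 0, this errs in the
    -- favorable direction.
    have h3 : (μ j / μ k) ^ 2 * b ≤ μ j / μ k * b := by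
      refine mul_le_mul_of_nonneg_right ?_ hb0
      rw [sq]
      refine mul_le_of_le_one_left (by positivity) ?_
      rw [div_le_one hμk]; linarith
    have h4 : μ j / μ k * p (z (s k + 1)) (V x) - p (z (s j + 1)) (V x) = a - μ j / μ k * b := by
      rw [ha, hb]; ring
    rw [h4]; linarith

end IsLocalDescent

/-! ### Recurrence and convergence of perturbed dual averaging -/

namespace IsLocalDescent

section
variable {E : Type*} [NormedAddCommGroup E] [NormedSpace ℝ E]
  {p : E →L[ℝ] E →L[ℝ] ℝ} {f : E → ℝ} {Q V : E → E} {x : E} {κ c C R : ℝ}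

/-- A path that stays ρ away from x lowers f - p x by at least γ c ρ²/2 at every late step. That
function is nonnegative and the step-sizes are not summable. -/
theorem exists_near (h : IsLocalDescent p f Q V x κ c C R) {ρ : ℝ} (hρ : 0 < ρ)
    {Y W : ℕ → E} {γ : ℕ → ℝ} (hγ : ∀ n, 0 < γ n) (hγ0 : Tendsto γ atTop (𝓝 0))
    (hγs : ¬ Summable γ) (hW : CauchySeq W)
    (hrun : ∀ n, Y (n + 1) - W (n + 1) = Y n - W n + γ n • V (Q (Y n)))
    (hloc : ∀ n, ‖Q (Y n) - x‖ ≤ R) (m : ℕ) : ∃ n ≥ m, ‖Q (Y n) - x‖ < ρ := by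
  by_contra! hcon
  obtain ⟨K, hK, herr⟩ := h.exists_errors
  have hc := h.c_pos
  set θ := c * ρ ^ 2 / (2 * K) with hθ
  have hθ0 : 0 < θ := by positivity
  have hKθ : K * θ = c * ρ ^ 2 / 2 := by rw [hθ]; field_simp
  obtain ⟨m₁, hm₁⟩ := eventually_atTop.1 (hγ0.eventually_le_const hθ0)
  obtain ⟨m₂, hm₂⟩ := Metric.cauchySeq_iff.1 hW θ hθ0
  set M := max m (max m₁ m₂) with hM
  have hMm : m ≤ M := le_max_left _ _
  have hMm₁ : m₁ ≤ M := (le_max_left _ _).trans (le_max_right _ _)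
  have hMm₂ : m₂ ≤ M := (le_max_right _ _).trans (le_max_right _ _)
  obtain ⟨hstep, -, -⟩ := herr θ hθ0.le (fun n => Y (n + M)) (fun n => W (n + M) - W M)
    (fun n => γ (n + M)) (fun n => hγ _) (fun n => hm₁ _ (by omega))
    (fun n => by
      rw [← dist_eq_norm]
      exact (hm₂ _ (by omega) _ (by omega)).le)
    (fun n => by
      have h1 := hrun (n + M)
      have h2 : n + 1 + M = n + M + 1 := by ring
      rw [h2, sub_sub_eq_add_sub, add_sub_right_comm, h1]; abel)
  set Φ : ℕ → ℝ := fun n => f (Y (n + M) - (W (n + M) - W M)) -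
    p x (Y (n + M) - (W (n + M) - W M)) with hΦ
  have hΦ0 : ∀ n, 0 ≤ Φ n := fun n => sub_nonneg.2 (h.lower _)
  have hdec : ∀ n, Φ (n + 1) ≤ Φ n - γ (n + M) * (c * ρ ^ 2 / 2) := by
    intro n
    have h1 := hstep n (hloc _)
    have h2 := h.monotone _ (hloc (n + M))
    have h3 := h.vi (Y (n + M))
    rw [map_sub] at h2
    have h4 : ρ ^ 2 ≤ ‖Q (Y (n + M)) - x‖ ^ 2 := pow_le_pow_left₀ hρ.le (hcon _ (by omega)) 2
    have h5 : p (Q (Y (n + M)) - x) (V (Q (Y (n + M)))) + K * θ ≤ -(c * ρ ^ 2 / 2) := by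
      rw [hKθ]
      nlinarith
    have h6 := mul_le_mul_of_nonneg_left h5 (hγ (n + M)).le
    simp only [hΦ]
    linarith
  have hsum : ∀ n, ∑ i ∈ Finset.range n, γ (i + M) ≤ Φ 0 / (c * ρ ^ 2 / 2) := by
    intro n
    have h1 : Φ n ≤ Φ 0 - (∑ i ∈ Finset.range n, γ (i + M)) * (c * ρ ^ 2 / 2) := by
      induction n with
      | zero => simp
      | succ n ih =>
        rw [Finset.sum_range_succ]
        linarith [hdec n]
    rw [le_div_iff₀ (by positivity)]
    linarith [hΦ0 n]
  exact hγs ((summable_nat_add_iff M).1 (summable_of_sum_range_le (fun n => (hγ _).le) hsum))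

end

variable {E : Type*} [NormedAddCommGroup E] [NormedSpace ℝ E] [FiniteDimensional ℝ E]
  {p : E →L[ℝ] E →L[ℝ] ℝ} {f : E → ℝ} {Q V : E → E} {x : E} {κ c C R : ℝ}

/-- Perturbed dual averaging that starts close to `x` converges to `x`, provided the perturbations
are small and convergent and the steps are small. -/
theorem tendsto (h : IsLocalDescent p f Q V x κ c C R) :
    ∃ r > 0, ∃ θ > 0, ∀ (Y W : ℕ → E) (γ : ℕ → ℝ), (∀ n, 0 < γ n) →
      (∀ n, γ n ≤ θ) → Tendsto γ atTop (𝓝 0) → ¬ Summable γ → (∀ n, ‖W n‖ ≤ θ) → CauchySeq W →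
      (∀ n, Y (n + 1) - W (n + 1) = Y n - W n + γ n • V (Q (Y n))) →
      ‖Q (Y 0) - x‖ < r → Tendsto (fun n => Q (Y n)) atTop (𝓝 x) := by
  obtain ⟨r, hr, θ, hθ, hstay⟩ := h.stay h.R_pos le_rfl
  refine ⟨r, hr, θ, hθ, fun Y W γ hγ hγθ hγ0 hγs hWθ hW hrun hstart => ?_⟩
  have hloc := hstay Y W γ hγ hγθ hWθ hrun hstart
  rw [Metric.tendsto_atTop]
  intro ε hε
  obtain ⟨r', hr', θ', hθ', hstay'⟩ := h.stay (ρ := min (ε / 2) R)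
    (lt_min (by positivity) h.R_pos) (min_le_right _ _)
  obtain ⟨m₁, hm₁⟩ := eventually_atTop.1 (hγ0.eventually_le_const hθ')
  obtain ⟨m₂, hm₂⟩ := Metric.cauchySeq_iff.1 hW θ' hθ'
  obtain ⟨M, hM, hnear⟩ := h.exists_near hr' hγ hγ0 hγs hW hrun hloc (max m₁ m₂)
  have hMm₁ : m₁ ≤ M := (le_max_left _ _).trans hM
  have hMm₂ : m₂ ≤ M := (le_max_right _ _).trans hM
  -- Restart at a late time M when Q Y is near x. Replacing W by W - W M shifts the noiseless score
  -- by a constant and makes the remaining perturbation small, by the Cauchy property.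
  have hfin := hstay' (fun n => Y (n + M)) (fun n => W (n + M) - W M)
    (fun n => γ (n + M)) (fun n => hγ _) (fun n => hm₁ _ (by omega))
    (fun n => by
      rw [← dist_eq_norm]
      exact (hm₂ _ (by omega) _ (by omega)).le)
    (fun n => by
      have h1 := hrun (n + M)
      have h2 : n + 1 + M = n + M + 1 := by ring
      rw [h2, sub_sub_eq_add_sub, add_sub_right_comm, h1]; abel)
    (by simpa using hnear)
  refine ⟨M, fun n hn => ?_⟩
  have h1 := hfin (n - M)
  simp only [Nat.sub_add_cancel hn] at h1
  rw [dist_eq_norm]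
  exact lt_of_le_of_lt (h1.trans (min_le_left _ _)) (by linarith)

end IsLocalDescent

/-! ### Spectral calculus and cocoercivity for the free energy -/

/-- The Hermitian matrix `U diag(a) U⋆`. -/
noncomputable def conjDiag {m : ℕ} (U : Matrix (Fin m) (Fin m) ℂ) (a : Fin m → ℝ) :
    Matrix (Fin m) (Fin m) ℂ :=
  U * Matrix.diagonal (fun i => (a i : ℂ)) * star U

section conjDiag

variable {m : ℕ}

/-- The squared overlaps of two eigenbases reduce trace inequalities for non-commuting matrices to
weighted scalar ones; for unitary U and V the weights are doubly stochastic. -/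
theorem trace_conjDiag_mul (U V : Matrix (Fin m) (Fin m) ℂ) (a b : Fin m → ℝ) :
    (conjDiag U a * conjDiag V b).trace.re =
      ∑ i, ∑ j, Complex.normSq ((star U * V) i j) * (a i * b j) := by
  have h1 : (conjDiag U a * conjDiag V b).trace =
      (Matrix.diagonal (fun i => (a i : ℂ)) * ((star U * V) *
        Matrix.diagonal (fun i => (b i : ℂ)) * star (star U * V))).trace := by
    rw [conjDiag, conjDiag, mul_assoc, mul_assoc, Matrix.trace_mul_comm]
    simp only [star_mul, star_star, mul_assoc]
  rw [h1]
  simp only [Matrix.trace, Matrix.diag, Matrix.diagonal_mul, Complex.re_sum]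
  refine Finset.sum_congr rfl fun i _ => ?_
  rw [Matrix.mul_apply, Finset.mul_sum, Complex.re_sum]
  refine Finset.sum_congr rfl fun j _ => ?_
  rw [Matrix.mul_diagonal, Matrix.star_apply, Complex.star_def,
    show ∀ x y z w : ℂ, x * (y * z * w) = x * z * (y * w) by intros; ring, Complex.mul_conj,
    ← Complex.ofReal_mul, ← Complex.ofReal_mul, Complex.ofReal_re]
  ring

theorem sum_normSq_row {T : Matrix (Fin m) (Fin m) ℂ} (hT : T ∈ Matrix.unitaryGroup (Fin m) ℂ)
    (i : Fin m) : ∑ j, Complex.normSq (T i j) = 1 := by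
  have h := congrFun (congrFun (Matrix.mem_unitaryGroup_iff.1 hT) i) i
  rw [Matrix.mul_apply, Matrix.one_apply_eq] at h
  simp only [Matrix.star_apply, Complex.star_def, Complex.mul_conj] at h
  exact_mod_cast h

theorem sum_normSq_col {T : Matrix (Fin m) (Fin m) ℂ} (hT : T ∈ Matrix.unitaryGroup (Fin m) ℂ)
    (j : Fin m) : ∑ i, Complex.normSq (T i j) = 1 := by
  have h := congrFun (congrFun (Matrix.mem_unitaryGroup_iff'.1 hT) j) j
  rw [Matrix.mul_apply, Matrix.one_apply_eq] at h
  simp only [Matrix.star_apply, Complex.star_def, mul_comm _ (T _ j), Complex.mul_conj] at h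
  exact_mod_cast h

theorem trace_conjDiag {U : Matrix (Fin m) (Fin m) ℂ} (hU : U ∈ Matrix.unitaryGroup (Fin m) ℂ)
    (a : Fin m → ℝ) : (conjDiag U a).trace.re = ∑ i, a i := by
  rw [conjDiag, Matrix.trace_mul_comm, ← mul_assoc, Matrix.mem_unitaryGroup_iff'.1 hU, one_mul,
    Matrix.trace_diagonal, Complex.re_sum]
  simp

theorem conjDiag_posSemidef (U : Matrix (Fin m) (Fin m) ℂ) {a : Fin m → ℝ} (ha : ∀ i, 0 ≤ a i) :
    (conjDiag U a).PosSemidef := by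
  have h : (Matrix.diagonal (fun i => (a i : ℂ))).PosSemidef :=
    Matrix.PosSemidef.diagonal fun i => by simpa using ha i
  simpa [conjDiag, Matrix.star_eq_conjTranspose] using h.mul_mul_conjTranspose_same U

theorem exp_conjDiag {U : Matrix (Fin m) (Fin m) ℂ} (hU : U ∈ Matrix.unitaryGroup (Fin m) ℂ)
    (a : Fin m → ℝ) : NormedSpace.exp (conjDiag U a) = conjDiag U fun i => Real.exp (a i) := by
  have hinv : star U = U⁻¹ := (Matrix.inv_eq_left_inv (Matrix.mem_unitaryGroup_iff'.1 hU)).symm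
  have hunit : IsUnit U := IsUnit.of_mul_eq_one _ (Matrix.mem_unitaryGroup_iff.1 hU)
  rw [conjDiag, conjDiag, hinv, Matrix.exp_conj U _ hunit, Matrix.exp_diagonal]
  congr 3
  ext i
  simp [Pi.coe_exp, ← Complex.exp_eq_exp_ℂ]

end conjDiag

namespace Herm

variable {m : ℕ}

theorem exists_conjDiag (Y : Herm m) : ∃ U ∈ Matrix.unitaryGroup (Fin m) ℂ,
    (Y : Matrix (Fin m) (Fin m) ℂ) = conjDiag U Y.isHermitian.eigenvalues := by
  refine ⟨Y.isHermitian.eigenvectorUnitary, Y.isHermitian.eigenvectorUnitary.2, ?_⟩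
  exact Y.isHermitian.spectral_theorem

theorem nuclearNorm_of_posSemidef {X : Herm m} (hX : (X : Matrix (Fin m) (Fin m) ℂ).PosSemidef) :
    X.nuclearNorm = (X : Matrix (Fin m) (Fin m) ℂ).trace.re := by
  rw [X.isHermitian.trace_eq_sum_eigenvalues, nuclearNorm, Complex.re_sum]
  refine Finset.sum_congr rfl fun i _ => ?_
  rw [abs_of_nonneg (X.isHermitian.posSemidef_iff_eigenvalues_nonneg.1 hX i)]
  simp

theorem exp_posSemidef (Y : Herm m) : (Y.exp : Matrix (Fin m) (Fin m) ℂ).PosSemidef := by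
  obtain ⟨U, hU, h⟩ := Y.exists_conjDiag
  change (NormedSpace.exp (Y : Matrix (Fin m) (Fin m) ℂ)).PosSemidef
  rw [h, exp_conjDiag hU]
  exact conjDiag_posSemidef U fun i => (Real.exp_pos _).le

theorem nuclearNorm_exp_nonneg (Y : Herm m) : 0 ≤ Y.exp.nuclearNorm :=
  Finset.sum_nonneg fun _ _ => abs_nonneg _

/-- The normalized exponential `exp Y / (1 + tr exp Y)`. -/
noncomputable def softmax (Y : Herm m) : Herm m := (1 / (1 + Y.exp.nuclearNorm)) • Y.exp

/-- The free energy `log (1 + tr exp Y)`. -/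
noncomputable def freeEnergy (Y : Herm m) : ℝ := Real.log (1 + Y.exp.nuclearNorm)

theorem exp_freeEnergy (Y : Herm m) : Real.exp Y.freeEnergy = 1 + Y.exp.nuclearNorm :=
  Real.exp_log (by have := Y.nuclearNorm_exp_nonneg; positivity)

theorem freeEnergy_nonneg (Y : Herm m) : 0 ≤ Y.freeEnergy :=
  Real.log_nonneg (by have := Y.nuclearNorm_exp_nonneg; linarith)

/-- The term exp(-`freeEnergy`) is the missing mass 1 - tr(softmax), which acts as one additional
eigenvalue. -/
theorem exists_spectral (Y : Herm m) : ∃ U ∈ Matrix.unitaryGroup (Fin m) ℂ, ∃ a : Fin m → ℝ,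
    (Y : Matrix (Fin m) (Fin m) ℂ) = conjDiag U a ∧
    (Y.softmax : Matrix (Fin m) (Fin m) ℂ) = conjDiag U (fun i => Real.exp (a i - Y.freeEnergy)) ∧
    ∑ i, Real.exp (a i - Y.freeEnergy) + Real.exp (-Y.freeEnergy) = 1 := by
  obtain ⟨U, hU, h⟩ := Y.exists_conjDiag
  set a := Y.isHermitian.eigenvalues
  have hexp : (Y.exp : Matrix (Fin m) (Fin m) ℂ) = conjDiag U fun i => Real.exp (a i) := by
    change NormedSpace.exp (Y : Matrix (Fin m) (Fin m) ℂ) = _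
    rw [h, exp_conjDiag hU]
  have hnn : Y.exp.nuclearNorm = ∑ i, Real.exp (a i) := by
    rw [nuclearNorm_of_posSemidef Y.exp_posSemidef, hexp, trace_conjDiag hU]
  have hG := Y.exp_freeEnergy
  have hmul : ∀ i, Real.exp (a i - Y.freeEnergy) = 1 / (1 + Y.exp.nuclearNorm) * Real.exp (a i) := by
    intro i; rw [Real.exp_sub, hG]; ring
  refine ⟨U, hU, a, h, ?_, ?_⟩
  · have h1 : (Y.softmax : Matrix (Fin m) (Fin m) ℂ) =
        (1 / (1 + Y.exp.nuclearNorm)) • (Y.exp : Matrix (Fin m) (Fin m) ℂ) := rfl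
    rw [h1, hexp, conjDiag, conjDiag, ← Matrix.smul_mul, ← Matrix.mul_smul, ← Matrix.diagonal_smul]
    congr 3
    ext i
    rw [hmul]
    simp
  · have := Y.nuclearNorm_exp_nonneg
    simp only [hmul, ← Finset.mul_sum, ← hnn]
    rw [Real.exp_neg, hG]
    field_simp
    ring

/-- With u = e^(s/2) and v = e^(t/2), the tangent inequality 1 + x ≤ e^x gives u² - v² + (u - v)² ≤
u²(s - t), and (u² - v²)² ≤ 4(u - v)² because u + v ≤ 2. -/
theorem klein_scalar {s t : ℝ} (hs : s ≤ 0) (ht : t ≤ 0) :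
    Real.exp s - Real.exp t + 1 / 4 * (Real.exp s - Real.exp t) ^ 2 ≤ Real.exp s * (s - t) := by
  have h1 := Real.add_one_le_exp ((t - s) / 2)
  have hu : Real.exp (s / 2) ≤ 1 := Real.exp_le_one_iff.2 (by linarith)
  have hv : Real.exp (t / 2) ≤ 1 := Real.exp_le_one_iff.2 (by linarith)
  have hu0 := Real.exp_pos (s / 2)
  have hv0 := Real.exp_pos (t / 2)
  have hs2 : Real.exp s = Real.exp (s / 2) ^ 2 := by rw [← Real.exp_nat_mul]; congr 1; ring
  have ht2 : Real.exp t = Real.exp (t / 2) ^ 2 := by rw [← Real.exp_nat_mul]; congr 1; ring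
  have hr : Real.exp (s / 2) * Real.exp ((t - s) / 2) = Real.exp (t / 2) := by
    rw [← Real.exp_add]; congr 1; ring
  rw [hs2, ht2]
  set u := Real.exp (s / 2)
  set v := Real.exp (t / 2)
  have h2 : u * (u * ((t - s) / 2 + 1)) ≤ u * v := by
    rw [← hr]
    exact mul_le_mul_of_nonneg_left (mul_le_mul_of_nonneg_left h1 hu0.le) hu0.le
  have h3 : (u ^ 2 - v ^ 2) ^ 2 ≤ 4 * (u - v) ^ 2 := by
    have h4 : (u + v) ^ 2 ≤ 2 ^ 2 := pow_le_pow_left₀ (by positivity) (by linarith) 2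
    have := mul_le_mul_of_nonneg_right h4 (sq_nonneg (u - v))
    linarith [show (u ^ 2 - v ^ 2) ^ 2 = (u + v) ^ 2 * (u - v) ^ 2 by ring]
  linarith [show u * (u * ((t - s) / 2 + 1)) = u ^ 2 - u ^ 2 * (s - t) / 2 by ring,
    show (u - v) ^ 2 = u ^ 2 - 2 * (u * v) + v ^ 2 by ring]

theorem tracePairing_apply (A B : Herm m) : tracePairing m A B =
    ((A : Matrix (Fin m) (Fin m) ℂ) * (B : Matrix (Fin m) (Fin m) ℂ)).trace.re := rfl

theorem tracePairing_comm (A B : Herm m) : tracePairing m A B = tracePairing m B A := by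
  rw [tracePairing_apply, tracePairing_apply, Matrix.trace_mul_comm]

theorem tracePairing_self_pos {A : Herm m} (hA : A ≠ 0) : 0 < tracePairing m A A := by
  obtain ⟨U, hU, h⟩ := A.exists_conjDiag
  set a := A.isHermitian.eigenvalues
  have h1 : tracePairing m A A = ∑ i, a i ^ 2 := by
    rw [tracePairing_apply, h, trace_conjDiag_mul, Matrix.mem_unitaryGroup_iff'.1 hU]
    refine Finset.sum_congr rfl fun i _ => ?_
    rw [Finset.sum_eq_single i]
    · simp [sq]
    · intro j _ hj; simp [Matrix.one_apply_ne hj.symm]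
    · simp
  rw [h1]
  refine lt_of_le_of_ne (Finset.sum_nonneg fun i _ => sq_nonneg _) fun h0 => hA ?_
  have h2 := (Finset.sum_eq_zero_iff_of_nonneg (fun i _ => sq_nonneg (a i))).1 h0.symm
  have h3 : ∀ i, a i = 0 := fun i => pow_eq_zero_iff (two_ne_zero) |>.1 (h2 i (Finset.mem_univ i))
  refine Subtype.ext ?_
  rw [h, conjDiag]
  simp [h3]

/-- Co-coercivity of the gradient of the free energy. -/
theorem freeEnergy_cocoercive (Y Y' : Herm m) :
    Y.freeEnergy + tracePairing m Y.softmax (Y' - Y) +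
      1 / 4 * tracePairing m (Y'.softmax - Y.softmax) (Y'.softmax - Y.softmax) ≤ Y'.freeEnergy := by
  obtain ⟨U, hU, a, hY, hX, hsum⟩ := Y.exists_spectral
  obtain ⟨W, hW, b, hY', hX', hsum'⟩ := Y'.exists_spectral
  set g := Y.freeEnergy
  set g' := Y'.freeEnergy
  set T := star U * W with hT
  have hTu : T ∈ Matrix.unitaryGroup (Fin m) ℂ :=
    mul_mem (Unitary.star_mem hU) hW
  set w : Fin m → Fin m → ℝ := fun i j => Complex.normSq (T i j) with hw
  have hw0 : ∀ i j, 0 ≤ w i j := fun i j => Complex.normSq_nonneg _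
  have hrow : ∀ i, ∑ j, w i j = 1 := sum_normSq_row hTu
  have hcol : ∀ j, ∑ i, w i j = 1 := sum_normSq_col hTu
  have hdiag : ∀ (c d : Fin m → ℝ) (S : Matrix (Fin m) (Fin m) ℂ),
      S ∈ Matrix.unitaryGroup (Fin m) ℂ → (conjDiag S c * conjDiag S d).trace.re =
        ∑ i, c i * d i := by
    intro c d S hS
    rw [trace_conjDiag_mul, Matrix.mem_unitaryGroup_iff'.1 hS]
    refine Finset.sum_congr rfl fun i _ => ?_
    rw [Finset.sum_eq_single i]
    · simp
    · intro j _ hj; simp [Matrix.one_apply_ne hj.symm]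
    · simp
  have hsumrow : ∀ c : Fin m → ℝ, ∑ i, ∑ j, w i j * c i = ∑ i, c i := by
    intro c
    simp only [← Finset.sum_mul, hrow, one_mul]
  have hsumcol : ∀ c : Fin m → ℝ, ∑ i, ∑ j, w i j * c j = ∑ j, c j := by
    intro c
    rw [Finset.sum_comm]
    simp only [← Finset.sum_mul, hcol, one_mul]
  set x : Fin m → ℝ := fun i => Real.exp (a i - g)
  set y : Fin m → ℝ := fun i => Real.exp (b i - g')
  have h1 : tracePairing m Y.softmax (Y' - Y) = ∑ i, ∑ j, w i j * (x i * (b j - a i)) := by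
    rw [map_sub, tracePairing_apply, tracePairing_apply, hX, hY, hY', hdiag _ _ U hU,
      trace_conjDiag_mul, ← hsumrow fun i => x i * a i, ← Finset.sum_sub_distrib]
    refine Finset.sum_congr rfl fun i _ => ?_
    rw [← Finset.sum_sub_distrib]
    refine Finset.sum_congr rfl fun j _ => ?_
    ring
  have h2 : tracePairing m (Y'.softmax - Y.softmax) (Y'.softmax - Y.softmax) =
      ∑ i, ∑ j, w i j * (x i - y j) ^ 2 := by
    have h3 : tracePairing m (Y'.softmax - Y.softmax) (Y'.softmax - Y.softmax) =
        tracePairing m Y'.softmax Y'.softmax - 2 * tracePairing m Y.softmax Y'.softmax +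
          tracePairing m Y.softmax Y.softmax := by
      rw [map_sub, map_sub, LinearMap.sub_apply, LinearMap.sub_apply,
        tracePairing_comm Y'.softmax Y.softmax]
      ring
    rw [h3, tracePairing_apply, tracePairing_apply, tracePairing_apply, hX, hX', hdiag _ _ U hU,
      hdiag _ _ W hW, trace_conjDiag_mul, ← hsumrow fun i => x i * x i,
      ← hsumcol fun j => y j * y j, Finset.mul_sum,
      ← Finset.sum_sub_distrib, ← Finset.sum_add_distrib]
    refine Finset.sum_congr rfl fun i _ => ?_
    rw [Finset.mul_sum, ← Finset.sum_sub_distrib, ← Finset.sum_add_distrib]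
    refine Finset.sum_congr rfl fun j _ => ?_
    ring
  have hx1 : ∀ i, a i - g ≤ 0 := by
    intro i
    rw [← Real.exp_le_one_iff, ← hsum]
    have := Finset.single_le_sum (f := x) (fun i _ => (Real.exp_pos _).le) (Finset.mem_univ i)
    have := Real.exp_pos (-g)
    linarith
  have hy1 : ∀ i, b i - g' ≤ 0 := by
    intro i
    rw [← Real.exp_le_one_iff, ← hsum']
    have := Finset.single_le_sum (f := y) (fun i _ => (Real.exp_pos _).le) (Finset.mem_univ i)
    have := Real.exp_pos (-g')
    linarith
  have hkl : ∑ i, ∑ j, w i j * (x i - y j + 1 / 4 * (x i - y j) ^ 2) ≤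
      ∑ i, ∑ j, w i j * (x i * ((a i - g) - (b j - g'))) :=
    Finset.sum_le_sum fun i _ => Finset.sum_le_sum fun j _ =>
      mul_le_mul_of_nonneg_left (klein_scalar (hx1 i) (hy1 j)) (hw0 i j)
  have hl : ∑ i, ∑ j, w i j * (x i - y j + 1 / 4 * (x i - y j) ^ 2) =
      ∑ i, x i - ∑ j, y j + 1 / 4 * ∑ i, ∑ j, w i j * (x i - y j) ^ 2 := by
    rw [← hsumrow x, ← hsumcol y, Finset.mul_sum, ← Finset.sum_sub_distrib,
      ← Finset.sum_add_distrib]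
    refine Finset.sum_congr rfl fun i _ => ?_
    rw [Finset.mul_sum, ← Finset.sum_sub_distrib, ← Finset.sum_add_distrib]
    refine Finset.sum_congr rfl fun j _ => ?_
    ring
  have hr : ∑ i, ∑ j, w i j * (x i * ((a i - g) - (b j - g'))) =
      -(∑ i, ∑ j, w i j * (x i * (b j - a i))) + (g' - g) * ∑ i, x i := by
    rw [← hsumrow x, Finset.mul_sum, ← Finset.sum_neg_distrib, ← Finset.sum_add_distrib]
    refine Finset.sum_congr rfl fun i _ => ?_
    rw [Finset.mul_sum, ← Finset.sum_neg_distrib, ← Finset.sum_add_distrib]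
    refine Finset.sum_congr rfl fun j _ => ?_
    ring
  -- The missing masses e^(-g) and e^(-g') obey the same scalar inequality. Adding it makes both
  -- spectra sum to 1, so the linear terms cancel.
  have hslack := klein_scalar (s := -g) (t := -g') (neg_nonpos.2 Y.freeEnergy_nonneg)
    (neg_nonpos.2 Y'.freeEnergy_nonneg)
  have hsq := sq_nonneg (Real.exp (-g) - Real.exp (-g'))
  have hxs : ∑ i, x i = 1 - Real.exp (-g) := by linarith
  have hys : ∑ i, y i = 1 - Real.exp (-g') := by linarith
  rw [hl, hr, hxs, hys] at hkl
  rw [h1, h2]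
  linarith

/-- Every eigenvalue of Y is at most log(1 + tr exp Y), and P ≽ 0 has trace at most A. This makes
the Lyapunov function nonnegative. -/
theorem tracePairing_le_freeEnergy {A : ℝ} {P : Herm m} (hP : P ∈ actionSet m A) (Y : Herm m) :
    tracePairing m P Y ≤ A * Y.freeEnergy := by
  obtain ⟨U, hU, h⟩ := P.exists_conjDiag
  obtain ⟨W, hW, b, hY, -, hsum⟩ := Y.exists_spectral
  have hl0 := P.isHermitian.posSemidef_iff_eigenvalues_nonneg.1 hP.1
  have hnn := hP.2
  rw [nuclearNorm_of_posSemidef hP.1, h, trace_conjDiag hU] at hnn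
  have hTu : star U * W ∈ Matrix.unitaryGroup (Fin m) ℂ := mul_mem (Unitary.star_mem hU) hW
  set l := P.isHermitian.eigenvalues
  have hb : ∀ j, b j ≤ Y.freeEnergy := by
    intro j
    rw [← sub_nonpos, ← Real.exp_le_one_iff, ← hsum]
    have := Finset.single_le_sum (f := fun i => Real.exp (b i - Y.freeEnergy))
      (fun i _ => (Real.exp_pos _).le) (Finset.mem_univ j)
    have := Real.exp_pos (-Y.freeEnergy)
    linarith
  rw [tracePairing_apply, h, hY, trace_conjDiag_mul]
  calc ∑ i, ∑ j, Complex.normSq ((star U * W) i j) * (l i * b j)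
      ≤ ∑ i, ∑ j, Complex.normSq ((star U * W) i j) * (l i * Y.freeEnergy) :=
        Finset.sum_le_sum fun i _ => Finset.sum_le_sum fun j _ =>
          mul_le_mul_of_nonneg_left (mul_le_mul_of_nonneg_left (hb j) (hl0 i))
            (Complex.normSq_nonneg _)
    _ = (∑ i, l i) * Y.freeEnergy := by
        simp only [← Finset.sum_mul, sum_normSq_row hTu, one_mul]
    _ ≤ A * Y.freeEnergy := mul_le_mul_of_nonneg_right hnn Y.freeEnergy_nonneg

end Herm

/-! ### The game as local descent data: potential, equilibrium, Hessian -/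

/-- A positive-definite continuous quadratic form on a finite-dimensional space is coercive. -/
theorem exists_coercive {E : Type*} [NormedAddCommGroup E] [NormedSpace ℝ E]
    [FiniteDimensional ℝ E] {B : E → ℝ} (hB : Continuous B)
    (hhom : ∀ (t : ℝ) x, B (t • x) = t ^ 2 * B x) (hpos : ∀ x ≠ 0, 0 < B x) :
    ∃ κ > 0, ∀ x, κ * ‖x‖ ^ 2 ≤ B x := by
  have := FiniteDimensional.proper ℝ E
  have h0 : B 0 = 0 := by simpa using hhom 0 0
  rcases (Metric.sphere (0 : E) 1).eq_empty_or_nonempty with he | hne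
  · refine ⟨1, one_pos, fun x => ?_⟩
    have hx : x = 0 := by
      by_contra hx
      have : (‖x‖⁻¹ • x) ∈ Metric.sphere (0 : E) 1 := by
        simp [norm_smul, norm_ne_zero_iff.2 hx]
      rw [he] at this
      exact this
    simp [hx, h0]
  · obtain ⟨y, hy, hmin⟩ := (isCompact_sphere (0 : E) 1).exists_isMinOn hne hB.continuousOn
    have hy1 : ‖y‖ = 1 := by simpa using hy
    refine ⟨B y, hpos y fun h => by simp [h] at hy1, fun x => ?_⟩
    by_cases hx : x = 0
    · simp [hx, h0]
    have hn : ‖x‖ ≠ 0 := norm_ne_zero_iff.2 hx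
    have h1 : B y ≤ B (‖x‖⁻¹ • x) := hmin (by simp [norm_smul, hn])
    rw [hhom, inv_pow] at h1
    have h2 := mul_le_mul_of_nonneg_right h1 (sq_nonneg ‖x‖)
    have h3 : (‖x‖ ^ 2)⁻¹ * B x * ‖x‖ ^ 2 = B x := by field_simp
    linarith

theorem ContinuousLinearMap.differentiableOn_comp_dual {E F : Type*} [NormedAddCommGroup E]
    [NormedSpace ℝ E] [NormedAddCommGroup F] [NormedSpace ℝ F] (L : (E →L[ℝ] ℝ) →L[ℝ] F)
    {g : E → E →L[ℝ] ℝ} {s : Set E} (hg : DifferentiableOn ℝ g s) :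
    DifferentiableOn ℝ (fun x => L (g x)) s :=
  L.differentiable.comp_differentiableOn hg

/-- The trace pairing of block-diagonal Hermitian matrices. -/
noncomputable def profilePairing {N : ℕ} (M : Fin N → ℕ) :
    Profile M →L[ℝ] Profile M →L[ℝ] ℝ :=
  (∑ i, (Herm.tracePairing (M i)).compl₁₂ (LinearMap.proj i : Profile M →ₗ[ℝ] Herm (M i))
    (LinearMap.proj i : Profile M →ₗ[ℝ] Herm (M i))).toContinuousBilinearMap

theorem profilePairing_apply {N : ℕ} {M : Fin N → ℕ} (X Y : Profile M) :
    profilePairing M X Y = ∑ i, Herm.tracePairing (M i) (X i) (Y i) := by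
  rw [profilePairing, LinearMap.toContinuousBilinearMap_apply]
  simp [LinearMap.sum_apply]

theorem mem_actionSet_iff {m : ℕ} {A : ℝ} {X : Herm m} : X ∈ actionSet m A ↔
    (X : Matrix (Fin m) (Fin m) ℂ).PosSemidef ∧
      (X : Matrix (Fin m) (Fin m) ℂ).trace.re ≤ A :=
  and_congr_right fun h => by rw [Herm.nuclearNorm_of_posSemidef h]

theorem convex_actionSet (m : ℕ) (A : ℝ) : Convex ℝ (actionSet m A) := by
  intro X hX Y hY a b ha hb hab
  rw [mem_actionSet_iff] at hX hY ⊢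
  have hcoe : ((a • X + b • Y : Herm m) : Matrix (Fin m) (Fin m) ℂ) =
    a • (X : Matrix (Fin m) (Fin m) ℂ) + b • (Y : Matrix (Fin m) (Fin m) ℂ) := rfl
  rw [hcoe]
  refine ⟨(hX.1.smul ha).add (hY.1.smul hb), ?_⟩
  rw [Matrix.trace_add, Matrix.trace_smul, Matrix.trace_smul, Complex.add_re, Complex.smul_re,
    Complex.smul_re, smul_eq_mul, smul_eq_mul]
  calc _ ≤ a * A + b * A := by gcongr; exacts [hX.2, hY.2]
    _ = A := by rw [← add_mul, hab, one_mul]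

-- Within spectral distance c of c·1 the spectrum lies in [0, 2c], so the trace is at most 2cm. This
-- supplies interior points, and hence unique derivatives on the feasible set.
open scoped MatrixOrder in
theorem mem_actionSet_of_norm_sub_le {m : ℕ} {A c : ℝ} (hA : 2 * c * m ≤ A) {X : Herm m}
    (hX : ‖X - c • (1 : Herm m)‖ ≤ c) : X ∈ actionSet m A := by
  have hsa : IsSelfAdjoint ((X - c • (1 : Herm m) : Herm m) : Matrix (Fin m) (Fin m) ℂ) :=
    (X - c • (1 : Herm m)).2
  have hcoe : ((X - c • (1 : Herm m) : Herm m) : Matrix (Fin m) (Fin m) ℂ) =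
    (X : Matrix (Fin m) (Fin m) ℂ) - c • (1 : Matrix (Fin m) (Fin m) ℂ) := rfl
  have hnorm : ‖((X - c • (1 : Herm m) : Herm m) : Matrix (Fin m) (Fin m) ℂ)‖ ≤ c := hX
  have hmono := algebraMap_mono (Matrix (Fin m) (Fin m) ℂ) hnorm
  have h1 := (neg_le_neg hmono).trans hsa.neg_algebraMap_norm_le_self
  have h2 := hsa.le_algebraMap_norm_self.trans hmono
  rw [Algebra.algebraMap_eq_smul_one, hcoe] at h1 h2
  have h3 : (0 : Matrix (Fin m) (Fin m) ℂ) ≤ X := by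
    have := add_le_add_left h1 (c • (1 : Matrix (Fin m) (Fin m) ℂ))
    simpa using this
  have h4 : (X : Matrix (Fin m) (Fin m) ℂ) ≤ (2 * c) • (1 : Matrix (Fin m) (Fin m) ℂ) := by
    have := sub_le_iff_le_add.1 h2
    rwa [← add_smul, ← two_mul] at this
  rw [mem_actionSet_iff]
  refine ⟨Matrix.nonneg_iff_posSemidef.1 h3, ?_⟩
  have h5 := (Complex.le_def.1 (Matrix.le_iff.1 h4).trace_nonneg).1
  rw [Matrix.trace_sub, Matrix.trace_smul, Matrix.trace_one, Complex.sub_re, Complex.smul_re] at h5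
  simp at h5
  linarith

namespace SemidefiniteGame

variable {N : ℕ} (G : SemidefiniteGame N)

theorem convex_feasible : Convex ℝ G.feasible := fun _ hX _ hY _ _ ha hb hab i =>
  convex_actionSet _ _ (hX i) (hY i) ha hb hab

theorem interior_feasible_nonempty : (interior G.feasible).Nonempty := by
  set c : Fin N → ℝ := fun i => G.A i / (2 * (G.M i + 1)) with hc
  have hc0 : ∀ i, 0 < c i := fun i => by have := G.A_pos i; positivity
  refine ⟨fun i => c i • 1, mem_interior_iff_mem_nhds.2 ?_⟩
  have hset : {X : Profile G.M | ∀ i, ‖X i - c i • (1 : Herm (G.M i))‖ ≤ c i} ⊆ G.feasible := by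
    intro X hX i
    refine mem_actionSet_of_norm_sub_le ?_ (hX i)
    have := G.A_pos i
    simp only [hc]
    rw [mul_div_assoc', div_mul_eq_mul_div, div_le_iff₀ (by positivity)]
    nlinarith
  have hev : ∀ᶠ X : Profile G.M in 𝓝 fun i => c i • (1 : Herm (G.M i)),
      ∀ i, ‖X i - c i • (1 : Herm (G.M i))‖ ≤ c i := ?_
  · exact mem_of_superset hev hset
  refine eventually_all.2 fun i => ?_
  have hcont : Continuous fun X : Profile G.M => ‖X i - c i • (1 : Herm (G.M i))‖ := by fun_prop
  refine (hcont.tendsto _).eventually_le_const ?_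
  simpa using hc0 i

theorem uniqueDiffOn_feasible : UniqueDiffOn ℝ G.feasible :=
  uniqueDiffOn_convex G.convex_feasible G.interior_feasible_nonempty

theorem choice_eq (Y : Profile G.M) (i : Fin N) :
    G.choice Y i = G.A i • (Y i).softmax := by
  rw [choice, Herm.softmax, smul_smul, mul_one_div]

theorem choice_mem (Y : Profile G.M) : G.choice Y ∈ G.feasible := by
  intro i
  have hA := G.A_pos i
  have hn := (Y i).nuclearNorm_exp_nonneg
  have hcoe : (G.choice Y i : Matrix (Fin (G.M i)) (Fin (G.M i)) ℂ) =
    (G.A i / (1 + (Y i).exp.nuclearNorm)) •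
      ((Y i).exp : Matrix (Fin (G.M i)) (Fin (G.M i)) ℂ) := rfl
  rw [mem_actionSet_iff, hcoe]
  refine ⟨(Y i).exp_posSemidef.smul (by positivity), ?_⟩
  rw [Matrix.trace_smul, Complex.smul_re, ← Herm.nuclearNorm_of_posSemidef (Y i).exp_posSemidef,
    smul_eq_mul, div_mul_eq_mul_div, div_le_iff₀ (by positivity)]
  nlinarith

/-- The convex potential whose gradient is the choice map. -/
noncomputable def potential (Y : Profile G.M) : ℝ := ∑ i, G.A i * (Y i).freeEnergy

/-- Apply the free-energy inequality block by block; `exists_coercive` converts the weighted trace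
form into the spectral norm, and the weight 1/(4 A_i) appears because `choice` is A_i times
`softmax`. -/
theorem potential_cocoercive : ∃ κ > 0, ∀ Y Y', G.potential Y +
    profilePairing G.M (G.choice Y) (Y' - Y) + κ * ‖G.choice Y' - G.choice Y‖ ^ 2 ≤
      G.potential Y' := by
  obtain ⟨κ, hκ, hcoer⟩ := exists_coercive (E := Profile G.M)
    (B := fun H => ∑ i, 1 / (4 * G.A i) * Herm.tracePairing (G.M i) (H i) (H i)) (by
      have : ∀ i, Continuous fun H : Profile G.M => Herm.tracePairing (G.M i) (H i) (H i) := by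
        intro i
        have h1 : Continuous fun H : Profile G.M =>
          (Herm.tracePairing (G.M i)).toContinuousBilinearMap (H i) (H i) := by fun_prop
        exact h1
      fun_prop)
    (by
      intro t H
      rw [Finset.mul_sum]
      refine Finset.sum_congr rfl fun i _ => ?_
      simp only [Pi.smul_apply, map_smul, LinearMap.smul_apply, smul_eq_mul]
      ring)
    (by
      intro H hH
      obtain ⟨i, hi⟩ := Function.ne_iff.1 hH
      have hA := G.A_pos
      have hnn : ∀ j, 0 ≤ Herm.tracePairing (G.M j) (H j) (H j) := by
        intro j
        by_cases hj : H j = 0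
        · simp [hj]
        · exact (Herm.tracePairing_self_pos hj).le
      refine Finset.sum_pos' (fun j _ => ?_) ⟨i, Finset.mem_univ i, ?_⟩
      · have := hA j; have := hnn j; positivity
      · have := hA i; have := Herm.tracePairing_self_pos hi; positivity)
  refine ⟨κ, hκ, fun Y Y' => ?_⟩
  have h1 := hcoer (G.choice Y' - G.choice Y)
  refine (add_le_add_right h1 _).trans ?_
  rw [potential, profilePairing_apply, potential, ← Finset.sum_add_distrib,
    ← Finset.sum_add_distrib]
  refine Finset.sum_le_sum fun i _ => ?_
  have hA := G.A_pos i
  have h2 := mul_le_mul_of_nonneg_left ((Y i).freeEnergy_cocoercive (Y' i)) hA.le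
  simp only [Pi.sub_apply, choice_eq, ← smul_sub, map_smul, LinearMap.smul_apply, smul_eq_mul]
  refine le_trans (le_of_eq ?_) h2
  field_simp

theorem pairing_le_potential {X : Profile G.M} (hX : X ∈ G.feasible) (Y : Profile G.M) :
    profilePairing G.M X Y ≤ G.potential Y := by
  rw [profilePairing_apply, potential]
  exact Finset.sum_le_sum fun i _ => Herm.tracePairing_le_freeEnergy (hX i) (Y i)

/-- Restriction of a functional to the `i`-th block, represented through the trace. -/
noncomputable def blockGradient (i : Fin N) : (Profile G.M →L[ℝ] ℝ) →L[ℝ] Herm (G.M i) :=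
  LinearMap.toContinuousLinearMap
    { toFun := fun φ => Herm.ofDual ((φ : Profile G.M →ₗ[ℝ] ℝ) ∘ₗ
        LinearMap.single ℝ (fun j => Herm (G.M j)) i)
      map_add' := fun φ ψ => by
        rw [Herm.ofDual, Herm.ofDual, Herm.ofDual, ← map_add]; rfl
      map_smul' := fun t φ => by
        rw [Herm.ofDual, Herm.ofDual, RingHom.id_apply, ← map_smul]; rfl }

theorem V_apply (X : Profile G.M) (i : Fin N) :
    G.V X i = G.blockGradient i (fderivWithin ℝ (G.u i) G.feasible X) := rfl

theorem pairing_blockGradient (H : Profile G.M) (i : Fin N) (φ : Profile G.M →L[ℝ] ℝ) :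
    Herm.tracePairing (G.M i) (H i) (G.blockGradient i φ) = φ (Pi.single i (H i)) := by
  rw [Herm.tracePairing_comm]
  exact Herm.trace_ofDual_mul _ (H i)

theorem differentiableOn_fderivWithin (i : Fin N) :
    DifferentiableOn ℝ (fderivWithin ℝ (G.u i) G.feasible) G.feasible :=
  ((G.smooth i).fderivWithin G.uniqueDiffOn_feasible (m := 1) (by norm_num)).differentiableOn
    (by norm_num)

theorem differentiableOn_V : DifferentiableOn ℝ G.V G.feasible := by
  refine (differentiableOn_pi (𝕜 := ℝ) (E := Profile G.M) (F' := fun i => Herm (G.M i))).2 fun i => ?_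
  exact ContinuousLinearMap.differentiableOn_comp_dual (E := Profile G.M) (F := Herm (G.M i))
    (G.blockGradient i) (G.differentiableOn_fderivWithin i)

variable {G}

/-- For each player, X* maximizes u_i along the feasible segment towards X_i, so the directional
derivative there is nonpositive; sum over the players. -/
theorem IsNash.pairing_nonpos {Xs : Profile G.M} (h : G.IsNash Xs) {X : Profile G.M}
    (hX : X ∈ G.feasible) : profilePairing G.M (X - Xs) (G.V Xs) ≤ 0 := by
  rw [profilePairing_apply]
  refine Finset.sum_nonpos fun i _ => ?_
  rw [V_apply, pairing_blockGradient]
  set s : Set (Profile G.M) := (fun Xi => Function.update Xs i Xi) '' actionSet (G.M i) (G.A i)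
    with hs
  have hsub : s ⊆ G.feasible := by
    rintro _ ⟨Xi, hXi, rfl⟩ j
    by_cases hj : j = i
    · subst hj; simpa using hXi
    · simpa [Function.update_of_ne hj] using h.1 j
  have hmax : IsLocalMaxOn (G.u i) s Xs := by
    refine eventually_of_mem self_mem_nhdsWithin ?_
    rintro _ ⟨Xi, hXi, rfl⟩
    exact h.2 i Xi hXi
  have hder : HasFDerivWithinAt (G.u i) (fderivWithin ℝ (G.u i) G.feasible Xs) s Xs :=
    (((G.smooth i).differentiableOn (by norm_num)) Xs h.1).hasFDerivWithinAt.mono hsub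
  refine hmax.hasFDerivWithinAt_nonpos hder (mem_posTangentConeAt_of_segment_subset ?_)
  intro Z hZ
  rw [segment_eq_image'] at hZ
  obtain ⟨t, ⟨ht0, ht1⟩, rfl⟩ := hZ
  refine ⟨Xs i + t • (X i - Xs i),
    (convex_actionSet _ _).add_smul_sub_mem (h.1 i) (hX i) ⟨ht0, ht1⟩, ?_⟩
  ext1 j
  by_cases hj : j = i
  · subst hj; simp
  · simp [Function.update_of_ne hj, Pi.single_eq_of_ne hj]

/-- Expand each gradient to first order at X*. On the diagonal (H, H) the two halves of the Hessian
blocks coincide after exchanging the summation indices, so the linear part is the negative-definite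
form; half of its coercivity absorbs the remainder. -/
theorem HessianNegDef.exists_monotone {Xs : Profile G.M} (hXs : Xs ∈ G.feasible)
    (hD : G.HessianNegDef Xs) : ∃ c > 0, ∀ᶠ X in 𝓝[G.feasible] Xs,
      profilePairing G.M (X - Xs) (G.V X - G.V Xs) ≤ -c * ‖X - Xs‖ ^ 2 := by
  set D : Fin N → Profile G.M →L[ℝ] Profile G.M →L[ℝ] ℝ := fun i =>
    fderivWithin ℝ (fderivWithin ℝ (G.u i) G.feasible) G.feasible Xs with hDdef
  have hform : ∀ H : Profile G.M, ∑ i, D i H (Pi.single i (H i)) =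
      ∑ i, ∑ j, G.hessianBlock i j Xs (H i) (H j) := by
    intro H
    have h1 : ∑ i, D i H (Pi.single i (H i)) =
        ∑ i, ∑ j, G.mixedDeriv i j i Xs (H j) (H i) := by
      refine Finset.sum_congr rfl fun i _ => ?_
      have h2 : D i H = ∑ j, D i (Pi.single j (H j)) := by
        conv_lhs => rw [← Finset.univ_sum_single H, map_sum]
      rw [h2, sum_apply]
      rfl
    have h3 : ∑ i, ∑ j, G.mixedDeriv j i j Xs (H i) (H j) =
        ∑ i, ∑ j, G.mixedDeriv i j i Xs (H j) (H i) := Finset.sum_comm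
    simp only [hessianBlock, Finset.sum_add_distrib, ← Finset.mul_sum]
    rw [h1, h3]
    ring
  obtain ⟨κ, hκ, hcoer⟩ := exists_coercive (E := Profile G.M)
    (B := fun H => -∑ i, D i H (Pi.single i (H i))) (by
      have : ∀ i, Continuous fun H : Profile G.M =>
          D i H (ContinuousLinearMap.single ℝ (fun j => Herm (G.M j)) i (H i)) := by
        intro i
        fun_prop
      exact (continuous_finsetSum _ fun i _ => this i).neg)
    (by
      intro t H
      rw [mul_neg, Finset.mul_sum]
      congr 1
      refine Finset.sum_congr rfl fun i _ => ?_
      have h1 : (Pi.single i ((t • H) i) : Profile G.M) = t • Pi.single i (H i) :=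
        (LinearMap.single ℝ (fun j => Herm (G.M j)) i).map_smul t (H i)
      rw [h1, map_smul, map_smul]
      simp only [smul_apply, smul_eq_mul]
      ring)
    (by
      intro H hH
      rw [hform]
      exact neg_pos.2 (hD H hH))
  refine ⟨κ / 2, by positivity, ?_⟩
  have hlo : ∀ i, ∀ᶠ X in 𝓝[G.feasible] Xs, ‖fderivWithin ℝ (G.u i) G.feasible X -
      fderivWithin ℝ (G.u i) G.feasible Xs - D i (X - Xs)‖ ≤ κ / (2 * (N + 1)) * ‖X - Xs‖ := by
    intro i
    exact (HasFDerivWithinAt.isLittleO (𝕜 := ℝ) (E := Profile G.M) (F := Profile G.M →L[ℝ] ℝ)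
      (G.differentiableOn_fderivWithin i Xs hXs).hasFDerivWithinAt).def (by positivity)
  filter_upwards [eventually_all.2 hlo] with X hX
  set z := X - Xs with hz
  have h1 : profilePairing G.M z (G.V X - G.V Xs) = ∑ i, (fderivWithin ℝ (G.u i) G.feasible X -
      fderivWithin ℝ (G.u i) G.feasible Xs) (Pi.single i (z i)) := by
    rw [profilePairing_apply]
    refine Finset.sum_congr rfl fun i _ => ?_
    rw [Pi.sub_apply, V_apply, V_apply, ← map_sub, pairing_blockGradient]
  have h2 : ∀ i, (fderivWithin ℝ (G.u i) G.feasible X -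
      fderivWithin ℝ (G.u i) G.feasible Xs) (Pi.single i (z i)) ≤
      D i z (Pi.single i (z i)) + κ / (2 * (N + 1)) * ‖z‖ ^ 2 := by
    intro i
    have h3 := (fderivWithin ℝ (G.u i) G.feasible X -
      fderivWithin ℝ (G.u i) G.feasible Xs - D i z).le_opNorm (Pi.single i (z i))
    have h4 : ‖(Pi.single i (z i) : Profile G.M)‖ ≤ ‖z‖ := by
      rw [Pi.norm_single]; exact norm_le_pi_norm z i
    have h5 := (le_abs_self _).trans (h3.trans
      (mul_le_mul (hX i) h4 (norm_nonneg _) (by positivity)))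
    rw [sub_apply] at h5
    linarith [show κ / (2 * (N + 1)) * ‖z‖ * ‖z‖ = κ / (2 * (N + 1)) * ‖z‖ ^ 2 by ring]
  have h3 := Finset.sum_le_sum fun i (_ : i ∈ Finset.univ) => h2 i
  rw [Finset.sum_add_distrib, Finset.sum_const, Finset.card_univ, Fintype.card_fin,
    nsmul_eq_mul] at h3
  have h4 := hcoer z
  have h5 : (N : ℝ) * (κ / (2 * (N + 1)) * ‖z‖ ^ 2) ≤ κ / 2 * ‖z‖ ^ 2 := by
    rw [← mul_assoc]
    refine mul_le_mul_of_nonneg_right ?_ (sq_nonneg _)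
    rw [mul_div_assoc', div_le_div_iff₀ (by positivity) (by positivity)]
    nlinarith
  rw [h1]
  linarith

theorem exists_isLocalDescent {Xs : Profile G.M} (hNash : G.IsNash Xs)
    (hD : G.HessianNegDef Xs) : ∃ κ c C R,
      IsLocalDescent (profilePairing G.M) G.potential G.choice G.V Xs κ c C R := by
  obtain ⟨κ, hκ, hcoc⟩ := G.potential_cocoercive
  obtain ⟨c, hc, hmono⟩ := hD.exists_monotone hNash.1
  obtain ⟨C, hC, hlip⟩ := (HasFDerivWithinAt.isBigO_sub (𝕜 := ℝ) (E := Profile G.M) (F := Profile G.M)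
    (G.differentiableOn_V Xs hNash.1).hasFDerivWithinAt).exists_pos
  obtain ⟨R, hR, hball⟩ := Metric.mem_nhdsWithin_iff.1 (hmono.and hlip.bound)
  have hin : ∀ Y, ‖G.choice Y - Xs‖ ≤ R / 2 → G.choice Y ∈ Metric.ball Xs R ∩ G.feasible :=
    fun Y hY => ⟨mem_ball_iff_norm.2 (by linarith), G.choice_mem Y⟩
  -- Halving R places the closed ball inside the open one where the estimates hold; capping c at 1
  -- lets the term -p z (V x) dominate c times itself in the descent argument.
  refine ⟨κ, min c 1, C, R / 2, hκ, by positivity, min_le_right _ _, hC.le, by positivity, hcoc,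
    G.pairing_le_potential hNash.1, fun Y => hNash.pairing_nonpos (G.choice_mem Y),
    fun Y hY => ((hball (hin Y hY)).1).trans ?_, fun Y hY => (hball (hin Y hY)).2⟩
  have := mul_le_mul_of_nonneg_right (min_le_left c 1) (sq_nonneg ‖G.choice Y - Xs‖)
  linarith

end SemidefiniteGame

/-! ### Martingale noise: maximal inequality and convergence -/

section martingale

variable {Ω : Type*} {m0 : MeasurableSpace Ω} {P : Measure Ω}
  {ℱ : Filtration ℕ m0} {d : ℕ → Ω → ℝ}

theorem stronglyMeasurable_sum_range (hd : ∀ n, StronglyMeasurable[ℱ (n + 1)] (d n)) (n : ℕ) :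
    StronglyMeasurable[ℱ n] fun ω => ∑ k ∈ Finset.range n, d k ω :=
  Finset.stronglyMeasurable_fun_sum _ fun k hk =>
    (hd k).mono (ℱ.mono (Nat.succ_le_of_lt (Finset.mem_range.1 hk)))

theorem memLp_sum_range (hd2 : ∀ n, MemLp (d n) 2 P) (n : ℕ) :
    MemLp (fun ω => ∑ k ∈ Finset.range n, d k ω) 2 P :=
  memLp_finsetSum _ fun k _ => hd2 k

variable [IsProbabilityMeasure P]

/-- Orthogonality of increments survives restriction to an event of ℱ 0, since its indicator can be
pulled out of the conditional expectation. This makes the later bounds proportional to the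
probability of that event. -/
theorem condExp_indicator_cross {A : Set Ω} (hA : MeasurableSet[ℱ 0] A)
    (hd : ∀ n, StronglyMeasurable[ℱ (n + 1)] (d n)) (hd2 : ∀ n, MemLp (d n) 2 P)
    (hd0 : ∀ n, P[d n | ℱ n] =ᵐ[P] 0) (n : ℕ) :
    Integrable ((A.indicator fun ω => 2 * ∑ k ∈ Finset.range n, d k ω) * d n) P ∧
      P[(A.indicator fun ω => 2 * ∑ k ∈ Finset.range n, d k ω) * d n | ℱ n] =ᵐ[P] 0 := by
  have hAn : MeasurableSet[ℱ n] A := ℱ.mono (Nat.zero_le n) A hA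
  have hsm : StronglyMeasurable[ℱ n] (A.indicator fun ω => 2 * ∑ k ∈ Finset.range n, d k ω) :=
    ((stronglyMeasurable_sum_range hd n).const_mul 2).indicator hAn
  have hint : Integrable ((A.indicator fun ω => 2 * ∑ k ∈ Finset.range n, d k ω) * d n) P :=
    (((memLp_sum_range hd2 n).const_mul 2).indicator (ℱ.le n A hAn)).integrable_mul (hd2 n)
  refine ⟨hint, ?_⟩
  filter_upwards [condExp_mul_of_stronglyMeasurable_left hsm hint
    ((hd2 n).integrable (by norm_num)), hd0 n] with ω h1 h2
  rw [h1, Pi.mul_apply, h2]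
  simp

theorem indicator_sq_succ (A : Set Ω) (n : ℕ) :
    (A.indicator fun ω => (∑ k ∈ Finset.range (n + 1), d k ω) ^ 2) =
      (A.indicator fun ω => (∑ k ∈ Finset.range n, d k ω) ^ 2) +
      ((A.indicator fun ω => 2 * ∑ k ∈ Finset.range n, d k ω) * d n +
        A.indicator fun ω => d n ω ^ 2) := by
  ext ω
  by_cases h : ω ∈ A
  · simp only [Pi.add_apply, Pi.mul_apply, Set.indicator_of_mem h, Finset.sum_range_succ]
    ring
  · simp [Set.indicator_of_notMem h]

theorem integral_indicator_sq_le {A : Set Ω} (hA : MeasurableSet[ℱ 0] A)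
    (hd : ∀ n, StronglyMeasurable[ℱ (n + 1)] (d n)) (hd2 : ∀ n, MemLp (d n) 2 P)
    (hd0 : ∀ n, P[d n | ℱ n] =ᵐ[P] 0) {v : ℕ → ℝ}
    (hv : ∀ n, ∫ ω in A, d n ω ^ 2 ∂P ≤ v n) (n : ℕ) :
    ∫ ω, A.indicator (fun ω => (∑ k ∈ Finset.range n, d k ω) ^ 2) ω ∂P ≤
      ∑ k ∈ Finset.range n, v k := by
  have hA0 : MeasurableSet A := ℱ.le 0 A hA
  induction n with
  | zero => simp
  | succ n ih =>
    obtain ⟨hint, hce⟩ := condExp_indicator_cross hA hd hd2 hd0 n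
    have h0 : ∫ ω, ((A.indicator fun ω => 2 * ∑ k ∈ Finset.range n, d k ω) * d n) ω ∂P = 0 := by
      rw [← integral_condExp (ℱ.le n), integral_congr_ae hce]
      simp
    have h1 : Integrable (A.indicator fun ω => (∑ k ∈ Finset.range n, d k ω) ^ 2) P :=
      ((memLp_sum_range hd2 n).integrable_sq).indicator hA0
    have h2 : Integrable (A.indicator fun ω => d n ω ^ 2) P :=
      ((hd2 n).integrable_sq).indicator hA0
    rw [indicator_sq_succ, integral_add' h1 (hint.add h2), integral_add' hint h2, h0,
      integral_indicator hA0 (f := fun ω => d n ω ^ 2), Finset.sum_range_succ]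
    linarith [hv n]

theorem submartingale_indicator_sq {A : Set Ω} (hA : MeasurableSet[ℱ 0] A)
    (hd : ∀ n, StronglyMeasurable[ℱ (n + 1)] (d n)) (hd2 : ∀ n, MemLp (d n) 2 P)
    (hd0 : ∀ n, P[d n | ℱ n] =ᵐ[P] 0) :
    Submartingale (fun n => A.indicator fun ω => (∑ k ∈ Finset.range n, d k ω) ^ 2) ℱ P := by
  have hA0 : MeasurableSet A := ℱ.le 0 A hA
  refine submartingale_of_condExp_sub_nonneg_nat (fun n => ?_) (fun n => ?_) fun n => ?_
  · exact ((stronglyMeasurable_sum_range hd n).pow 2).indicator (ℱ.mono (Nat.zero_le n) A hA)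
  · exact ((memLp_sum_range hd2 n).integrable_sq).indicator hA0
  · obtain ⟨hint, hce⟩ := condExp_indicator_cross hA hd hd2 hd0 n
    have h2 : Integrable (A.indicator fun ω => d n ω ^ 2) P :=
      ((hd2 n).integrable_sq).indicator hA0
    rw [indicator_sq_succ, add_sub_cancel_left]
    have h3 : 0 ≤ᵐ[P] P[A.indicator fun ω => d n ω ^ 2 | ℱ n] :=
      condExp_nonneg (ae_of_all _ fun ω => Set.indicator_nonneg (fun _ _ => sq_nonneg _) ω)
    filter_upwards [condExp_add hint h2 (ℱ n), hce, h3] with ω h4 h5 h6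
    rw [h4, Pi.add_apply, h5]
    simpa using h6

/-- Kolmogorov's maximal inequality, on an event known at time zero. -/
theorem measure_exists_le_abs_sum {A : Set Ω} (hA : MeasurableSet[ℱ 0] A)
    (hd : ∀ n, StronglyMeasurable[ℱ (n + 1)] (d n)) (hd2 : ∀ n, MemLp (d n) 2 P)
    (hd0 : ∀ n, P[d n | ℱ n] =ᵐ[P] 0) {v : ℝ}
    (hv : ∀ n, ∑ k ∈ Finset.range n, ∫ ω in A, d k ω ^ 2 ∂P ≤ v) {w : ℝ} (hw : 0 < w) :
    P (A ∩ {ω | ∃ n, w ≤ |∑ k ∈ Finset.range n, d k ω|}) ≤ ENNReal.ofReal (v / w ^ 2) := by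
  set S : ℕ → Ω → ℝ := fun n => A.indicator fun ω => (∑ k ∈ Finset.range n, d k ω) ^ 2 with hS
  have hS0 : 0 ≤ S := fun n ω => Set.indicator_nonneg (fun _ _ => sq_nonneg _) ω
  have hsub := submartingale_indicator_sq hA hd hd2 hd0
  set ε : NNReal := ⟨w ^ 2, sq_nonneg w⟩ with hε
  set B : ℕ → Set Ω := fun n =>
    {ω | (ε : ℝ) ≤ (Finset.range (n + 1)).sup' Finset.nonempty_range_add_one fun k => S k ω} with hB
  have hBmono : Monotone B := by
    intro n k hnk ω hω
    exact le_trans (b := (Finset.range (n + 1)).sup' Finset.nonempty_range_add_one fun k => S k ω)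
      hω (Finset.sup'_mono _ (Finset.range_mono (by omega)) _)
  have hBle : ∀ n, P (B n) ≤ ENNReal.ofReal (v / w ^ 2) := by
    intro n
    have h1 := maximal_ineq hsub hS0 (ε := ε) n
    have h2 : ∫ ω in B n, S n ω ∂P ≤ v := by
      refine (setIntegral_le_integral (hsub.integrable n) (ae_of_all _ (hS0 n))).trans ?_
      exact (integral_indicator_sq_le hA hd hd2 hd0 (fun n => le_rfl) n).trans (hv n)
    have h3 : (ε : ENNReal) * P (B n) ≤ ENNReal.ofReal v :=
      h1.trans (ENNReal.ofReal_le_ofReal h2)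
    have hε' : (ε : ENNReal) = ENNReal.ofReal (w ^ 2) := by
      rw [ENNReal.ofReal, Real.toNNReal_of_nonneg (sq_nonneg w)]
      rfl
    rw [hε'] at h3
    rw [ENNReal.ofReal_div_of_pos (by positivity)]
    refine (ENNReal.le_div_iff_mul_le (Or.inl ?_) (Or.inl ENNReal.ofReal_ne_top)).2 ?_
    · exact (ENNReal.ofReal_pos.2 (by positivity)).ne'
    · rwa [mul_comm]
  have hsubset : A ∩ {ω | ∃ n, w ≤ |∑ k ∈ Finset.range n, d k ω|} ⊆ ⋃ n, B n := by
    rintro ω ⟨hωA, n, hn⟩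
    refine Set.mem_iUnion.2 ⟨n, ?_⟩
    refine le_trans ?_ (Finset.le_sup' (fun k => S k ω) (Finset.self_mem_range_succ n))
    simp only [hS, Set.indicator_of_mem hωA]
    have := pow_le_pow_left₀ hw.le hn 2
    rwa [sq_abs] at this
  refine (measure_mono hsubset).trans ?_
  rw [hBmono.measure_iUnion]
  exact iSup_le hBle

/-- Almost sure convergence of a square-summable martingale series. -/
theorem ae_exists_tendsto_sum (hd : ∀ n, StronglyMeasurable[ℱ (n + 1)] (d n))
    (hd2 : ∀ n, MemLp (d n) 2 P) (hd0 : ∀ n, P[d n | ℱ n] =ᵐ[P] 0) {v : ℝ}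
    (hv : ∀ n, ∑ k ∈ Finset.range n, ∫ ω, d k ω ^ 2 ∂P ≤ v) :
    ∀ᵐ ω ∂P, ∃ c, Tendsto (fun n => ∑ k ∈ Finset.range n, d k ω) atTop (𝓝 c) := by
  have hint : ∀ n, Integrable (fun ω => ∑ k ∈ Finset.range n, d k ω) P := fun n =>
    (memLp_sum_range hd2 n).integrable (by norm_num)
  have hmart : Martingale (fun n ω => ∑ k ∈ Finset.range n, d k ω) ℱ P := by
    refine martingale_of_condExp_sub_eq_zero_nat (stronglyMeasurable_sum_range hd) hint fun n => ?_
    have : ((fun ω => ∑ k ∈ Finset.range (n + 1), d k ω) -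
        fun ω => ∑ k ∈ Finset.range n, d k ω) = d n := by
      ext ω; simp [Finset.sum_range_succ]
    rw [this]
    exact hd0 n
  have hbdd : ∀ n, eLpNorm (fun ω => ∑ k ∈ Finset.range n, d k ω) 1 P ≤
      ((1 + v).toNNReal : ENNReal) := by
    intro n
    rw [eLpNorm_one_eq_lintegral_enorm, ← ofReal_integral_norm_eq_lintegral_enorm (hint n)]
    refine ENNReal.ofReal_le_ofReal ?_
    have hsq := (memLp_sum_range hd2 n).integrable_sq
    -- The bound |x| ≤ 1 + x² turns the L² control into the L¹ bound needed for Doob's convergence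
    -- theorem.
    have h1 : ∫ ω, ‖∑ k ∈ Finset.range n, d k ω‖ ∂P ≤
        ∫ ω, (1 + (∑ k ∈ Finset.range n, d k ω) ^ 2) ∂P := by
      refine integral_mono (hint n).norm ((integrable_const 1).add hsq) fun ω => ?_
      rw [Real.norm_eq_abs, ← sq_abs]
      nlinarith [sq_nonneg (|∑ k ∈ Finset.range n, d k ω| - 1)]
    have h2 := integral_indicator_sq_le (ℱ := ℱ) (A := Set.univ) MeasurableSet.univ hd hd2 hd0
      (v := fun n => ∫ ω, d n ω ^ 2 ∂P) (fun n => by simp) n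
    simp only [Set.indicator_univ] at h2
    rw [integral_add (integrable_const 1) hsq] at h1
    simp only [integral_const, probReal_univ, smul_eq_mul, mul_one] at h1
    linarith [hv n]
  filter_upwards [hmart.submartingale.ae_tendsto_limitProcess hbdd] with ω hω
  exact ⟨_, hω⟩

/-- Weighted martingale-difference noise in a finite-dimensional space: the accumulated noise
converges almost surely and is uniformly small with high probability. -/
theorem exists_noise_bound (E : Type*) [NormedAddCommGroup E] [NormedSpace ℝ E]
    [FiniteDimensional ℝ E] : ∃ C : ℝ, 0 < C ∧
      ∀ {Ω : Type*} {m0 : MeasurableSpace Ω} {P : Measure Ω} [IsProbabilityMeasure P]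
        {ℱ : Filtration ℕ m0} {Z : ℕ → Ω → E} {γ : ℕ → ℝ} {σ : ℝ},
      (∀ n, StronglyMeasurable[ℱ (n + 1)] (Z n)) → (∀ n, Integrable (Z n) P) →
      (∀ n, Integrable (fun ω => ‖Z n ω‖ ^ 2) P) → (∀ n, P[Z n | ℱ n] =ᵐ[P] 0) →
      (∀ n A, MeasurableSet[ℱ 0] A → ∫ ω in A, ‖Z n ω‖ ^ 2 ∂P ≤ σ ^ 2 * P.real A) →
      (Summable fun n => γ n ^ 2) →
      (∀ᵐ ω ∂P, CauchySeq fun n => ∑ k ∈ Finset.range n, γ k • Z k ω) ∧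
      ∀ A, MeasurableSet[ℱ 0] A → ∀ w : ℝ, 0 < w →
        P (A ∩ {ω | ∃ n, w < ‖∑ k ∈ Finset.range n, γ k • Z k ω‖}) ≤
          ENNReal.ofReal (C * σ ^ 2 * (∑' n, γ n ^ 2) * P.real A / w ^ 2) := by
  have : CompleteSpace E := FiniteDimensional.complete ℝ E
  set b := Module.finBasis ℝ E
  set φ : Fin (Module.finrank ℝ E) → E →L[ℝ] ℝ := fun i => LinearMap.toContinuousLinearMap (b.coord i)
    with hφ
  have hrep : ∀ x : E, ∑ i, φ i x • b i = x := fun x => b.sum_repr x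
  set K := ∑ i, ‖b i‖ + 1 with hK
  have hK0 : 0 < K := by positivity
  -- A large vector has a large coordinate, so the scalar maximal inequality and a union bound over
  -- a basis suffice.
  have hnorm : ∀ (x : E) (w : ℝ), 0 < w → w < ‖x‖ → ∃ i, w / K ≤ |φ i x| := by
    intro x w hw hx
    by_contra! hcon
    have h1 : ‖x‖ ≤ ∑ i, w / K * ‖b i‖ := by
      conv_lhs => rw [← hrep x]
      refine (norm_sum_le _ _).trans (Finset.sum_le_sum fun i _ => ?_)
      rw [norm_smul]
      exact mul_le_mul_of_nonneg_right (hcon i).le (norm_nonneg _)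
    rw [← Finset.mul_sum] at h1
    have h2 : w / K * ∑ i, ‖b i‖ ≤ w / K * K := by
      refine mul_le_mul_of_nonneg_left ?_ (by positivity)
      rw [hK]; linarith
    rw [div_mul_cancel₀ _ hK0.ne'] at h2
    linarith
  refine ⟨K ^ 2 * ∑ i, ‖φ i‖ ^ 2 + 1, by positivity, ?_⟩
  intro Ω m0 P _ ℱ Z γ σ hZ hZ1 hZ2 hZ0 hZσ hγ
  set d : Fin (Module.finrank ℝ E) → ℕ → Ω → ℝ := fun i n ω => γ n * φ i (Z n ω) with hd
  have hdsum : ∀ i n ω, ∑ k ∈ Finset.range n, d i k ω =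
      φ i (∑ k ∈ Finset.range n, γ k • Z k ω) := by
    intro i n ω
    simp [hd, map_sum]
  have hdm : ∀ i n, StronglyMeasurable[ℱ (n + 1)] (d i n) := fun i n =>
    ((φ i).continuous.comp_stronglyMeasurable (hZ n)).const_mul (γ n)
  have hdle : ∀ i n ω, d i n ω ^ 2 ≤ γ n ^ 2 * ‖φ i‖ ^ 2 * ‖Z n ω‖ ^ 2 := by
    intro i n ω
    have h1 := (φ i).le_opNorm (Z n ω)
    have h2 := pow_le_pow_left₀ (norm_nonneg _) h1 2
    rw [Real.norm_eq_abs, sq_abs] at h2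
    have h3 := mul_le_mul_of_nonneg_left h2 (sq_nonneg (γ n))
    simp only [hd]
    linarith [show (γ n * φ i (Z n ω)) ^ 2 = γ n ^ 2 * φ i (Z n ω) ^ 2 by ring,
      show γ n ^ 2 * (‖φ i‖ * ‖Z n ω‖) ^ 2 = γ n ^ 2 * ‖φ i‖ ^ 2 * ‖Z n ω‖ ^ 2 by ring]
  have hd2 : ∀ i n, MemLp (d i n) 2 P := by
    intro i n
    have hm := ((hdm i n).mono (ℱ.le _)).aestronglyMeasurable (μ := P)
    refine (memLp_two_iff_integrable_sq hm).2 ?_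
    refine ((hZ2 n).const_mul (γ n ^ 2 * ‖φ i‖ ^ 2)).mono' (hm.pow 2) (ae_of_all _ fun ω => ?_)
    rw [Real.norm_of_nonneg (sq_nonneg _)]
    exact hdle i n ω
  have hd0 : ∀ i n, P[d i n | ℱ n] =ᵐ[P] 0 := by
    intro i n
    have h1 := ((γ n) • φ i).comp_condExp_comm (hZ1 n) (m := ℱ n)
    have h2 : (⇑((γ n) • φ i) ∘ Z n) = d i n := by
      ext ω; simp [hd]
    rw [h2] at h1
    filter_upwards [h1, hZ0 n] with ω h3 h4
    rw [← h3, Function.comp_apply, h4]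
    simp
  have hdv : ∀ i A, MeasurableSet[ℱ 0] A → ∀ n, ∑ k ∈ Finset.range n, ∫ ω in A, d i k ω ^ 2 ∂P ≤
      ‖φ i‖ ^ 2 * σ ^ 2 * (∑' n, γ n ^ 2) * P.real A := by
    intro i A hA n
    have h1 : ∀ k, ∫ ω in A, d i k ω ^ 2 ∂P ≤ γ k ^ 2 * (‖φ i‖ ^ 2 * σ ^ 2 * P.real A) := by
      intro k
      have h2 : ∫ ω in A, d i k ω ^ 2 ∂P ≤
          ∫ ω in A, γ k ^ 2 * ‖φ i‖ ^ 2 * ‖Z k ω‖ ^ 2 ∂P :=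
        integral_mono (hd2 i k).integrable_sq.integrableOn
          ((hZ2 k).const_mul _).integrableOn fun ω => hdle i k ω
      rw [integral_const_mul] at h2
      have h3 := mul_le_mul_of_nonneg_left (hZσ k A hA)
        (show 0 ≤ γ k ^ 2 * ‖φ i‖ ^ 2 by positivity)
      linarith
    refine (Finset.sum_le_sum fun k _ => h1 k).trans ?_
    rw [← Finset.sum_mul]
    have h2 : ∑ k ∈ Finset.range n, γ k ^ 2 ≤ ∑' n, γ n ^ 2 :=
      hγ.sum_le_tsum _ fun _ _ => sq_nonneg _
    have h3 := mul_le_mul_of_nonneg_right h2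
      (show 0 ≤ ‖φ i‖ ^ 2 * σ ^ 2 * P.real A by positivity)
    linarith
  constructor
  · have hae : ∀ᵐ ω ∂P, ∀ i, ∃ c, Tendsto (fun n => ∑ k ∈ Finset.range n, d i k ω) atTop (𝓝 c) := by
      refine ae_all_iff.2 fun i => ?_
      refine ae_exists_tendsto_sum (hdm i) (hd2 i) (hd0 i)
        (v := ‖φ i‖ ^ 2 * σ ^ 2 * (∑' n, γ n ^ 2) * P.real Set.univ) fun n => ?_
      simpa using hdv i Set.univ MeasurableSet.univ n
    filter_upwards [hae] with ω hω
    choose c hc using hω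
    have h1 : Tendsto (fun n => ∑ i, φ i (∑ k ∈ Finset.range n, γ k • Z k ω) • b i) atTop
        (𝓝 (∑ i, c i • b i)) := by
      refine tendsto_finsetSum _ fun i _ => ?_
      have := hc i
      simp only [hdsum] at this
      exact this.smul_const (b i)
    simp only [hrep] at h1
    exact h1.cauchySeq
  · intro A hA w hw
    have hsub : A ∩ {ω | ∃ n, w < ‖∑ k ∈ Finset.range n, γ k • Z k ω‖} ⊆
        ⋃ i, A ∩ {ω | ∃ n, w / K ≤ |∑ k ∈ Finset.range n, d i k ω|} := by
      rintro ω ⟨hωA, n, hn⟩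
      obtain ⟨i, hi⟩ := hnorm _ w hw hn
      refine Set.mem_iUnion.2 ⟨i, hωA, n, ?_⟩
      rwa [hdsum]
    refine (measure_mono hsub).trans ((measure_iUnion_fintype_le _ _).trans ?_)
    have hS0 : 0 ≤ ∑' n, γ n ^ 2 := tsum_nonneg fun _ => sq_nonneg _
    refine (Finset.sum_le_sum fun i _ => measure_exists_le_abs_sum hA (hdm i) (hd2 i) (hd0 i)
      (hdv i A hA) (by positivity)).trans ?_
    rw [← ENNReal.ofReal_sum_of_nonneg fun i _ => by positivity]
    refine ENNReal.ofReal_le_ofReal ?_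
    have h1 : ∑ i, ‖φ i‖ ^ 2 * σ ^ 2 * (∑' n, γ n ^ 2) * P.real A / (w / K) ^ 2 =
        (K ^ 2 * ∑ i, ‖φ i‖ ^ 2) * (σ ^ 2 * (∑' n, γ n ^ 2) * P.real A / w ^ 2) := by
      rw [Finset.mul_sum, Finset.sum_mul]
      refine Finset.sum_congr rfl fun i _ => ?_
      field_simp
    rw [h1]
    have h2 : 0 ≤ σ ^ 2 * (∑' n, γ n ^ 2) * P.real A / w ^ 2 := by positivity
    have h3 : (K ^ 2 * ∑ i, ‖φ i‖ ^ 2 + 1) * σ ^ 2 * (∑' n, γ n ^ 2) * P.real A / w ^ 2 =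
      (K ^ 2 * ∑ i, ‖φ i‖ ^ 2 + 1) * (σ ^ 2 * (∑' n, γ n ^ 2) * P.real A / w ^ 2) := by ring
    rw [h3]
    linarith

end martingale

/-! ### Measurability of the play and assembly of the theorem -/

theorem IsLocalDescent.continuous_Q {E : Type*} [NormedAddCommGroup E] [NormedSpace ℝ E]
    {p : E →L[ℝ] E →L[ℝ] ℝ} {f : E → ℝ} {Q V : E → E} {x : E} {κ c C R : ℝ}
    (h : IsLocalDescent p f Q V x κ c C R) : Continuous Q := by
  have hκ := h.κ_pos
  refine (LipschitzWith.of_dist_le_mul (K := (‖p‖ / (2 * κ)).toNNReal) fun Y Y' => ?_).continuous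
  rw [Real.coe_toNNReal _ (by positivity), dist_eq_norm, dist_eq_norm]
  exact h.norm_Q_sub_le Y' Y

theorem Herm.exp_injective (m : ℕ) : Function.Injective (Herm.exp (m := m)) := by
  intro Y Y' h
  have h1 : NormedSpace.exp (Y : Matrix (Fin m) (Fin m) ℂ) =
    NormedSpace.exp (Y' : Matrix (Fin m) (Fin m) ℂ) := congrArg Subtype.val h
  have h2 := congrArg CFC.log h1
  rw [CFC.log_exp _ Y.2, CFC.log_exp _ Y'.2] at h2
  exact Subtype.ext h2

/-- An injective continuous self-map of a finite-dimensional space loses no information. -/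
theorem stronglyMeasurable_of_comap_le {E Ω : Type*} [NormedAddCommGroup E] [NormedSpace ℝ E]
    [FiniteDimensional ℝ E] {Q : E → E} (hQ : Continuous Q) (hinj : Function.Injective Q)
    [m : MeasurableSpace Ω] {Y : Ω → E}
    (hY : MeasurableSpace.comap (fun ω => Q (Y ω)) (borel E) ≤ m) : StronglyMeasurable Y := by
  let _ : MeasurableSpace E := borel E
  have : BorelSpace E := ⟨rfl⟩
  have := FiniteDimensional.proper ℝ E
  -- Lusin–Souslin: a continuous injection between Polish spaces maps Borel sets to Borel sets.
  have hemb : MeasurableEmbedding Q := hQ.measurableEmbedding hinj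
  have h1 : Measurable (Q ∘ Y) := measurable_iff_comap_le.2 hY
  exact (hemb.measurable_comp_iff.1 h1).stronglyMeasurable

theorem summable_sq_of_rpow {γ : ℕ → ℝ} (hγ : ∀ n, 0 < γ n) {q : ℝ} (hq0 : 0 < q) (hq1 : q < 1)
    (hs : Summable fun n => γ n ^ (1 + q)) : Summable fun n => γ n ^ 2 := by
  refine Summable.of_norm_bounded_eventually_nat hs ?_
  filter_upwards [hs.tendsto_atTop_zero.eventually_lt_const one_pos] with n hn
  have h1 : γ n ≤ 1 := by
    by_contra! h
    exact absurd hn (not_lt.2 (Real.one_le_rpow h.le (by linarith)))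
  rw [Real.norm_of_nonneg (sq_nonneg _), ← Real.rpow_natCast]
  exact Real.rpow_le_rpow_of_exponent_ge (hγ n) h1 (by push_cast; linarith)

namespace SemidefiniteGame

variable {N : ℕ} {G : SemidefiniteGame N}

/-- The trace of X_i is A_i t/(1 + t) with t = tr exp Y_i, which determines t, then exp Y_i, and
then Y_i by the logarithm. -/
theorem choice_injective (G : SemidefiniteGame N) : Function.Injective G.choice := by
  intro Y Y' h
  ext1 i
  refine Herm.exp_injective _ ?_
  have hi : (G.A i / (1 + (Y i).exp.nuclearNorm)) • (Y i).exp =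
    (G.A i / (1 + (Y' i).exp.nuclearNorm)) • (Y' i).exp := congrFun h i
  have hA := G.A_pos i
  have ht := (Y i).nuclearNorm_exp_nonneg
  have ht' := (Y' i).nuclearNorm_exp_nonneg
  have h1 : G.A i / (1 + (Y i).exp.nuclearNorm) * (Y i).exp.nuclearNorm =
      G.A i / (1 + (Y' i).exp.nuclearNorm) * (Y' i).exp.nuclearNorm := by
    rw [Herm.nuclearNorm_of_posSemidef (Y i).exp_posSemidef,
      Herm.nuclearNorm_of_posSemidef (Y' i).exp_posSemidef] at hi ⊢
    have h2 := congrArg (fun X : Herm (G.M i) => (X : Matrix (Fin (G.M i)) (Fin (G.M i)) ℂ).trace.re) hi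
    simp only [selfAdjoint.val_smul, Matrix.trace_smul, Complex.smul_re, smul_eq_mul] at h2
    exact h2
  have h2 : (Y i).exp.nuclearNorm = (Y' i).exp.nuclearNorm := by
    rw [div_mul_eq_mul_div, div_mul_eq_mul_div, div_eq_div_iff (by positivity) (by positivity)] at h1
    refine mul_left_cancel₀ hA.ne' ?_
    linarith
  rw [h2] at hi
  exact smul_right_injective _ (by positivity) hi

variable {Ω : Type*} {m0 : MeasurableSpace Ω} {P : Measure Ω} {γ : ℕ → ℝ} {σ : ℝ}
  {Y Z : ℕ → Ω → Profile G.M}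

theorem continuous_V_choice (hc : Continuous G.choice) : Continuous fun Y => G.V (G.choice Y) :=
  G.differentiableOn_V.continuousOn.comp_continuous hc G.choice_mem

theorem IsMXLRun.stronglyMeasurable_score (h : G.IsMXLRun P γ σ Y Z) (hc : Continuous G.choice)
    (n : ℕ) : StronglyMeasurable (Y n) := by
  induction n with
  | zero => exact h.measurable_init
  | succ n ih =>
    have h1 : Y (n + 1) = fun ω => Y n ω + γ n • (G.V (G.choice (Y n ω)) + Z n ω) :=
      funext (h.update n)
    rw [h1]
    exact ih.add ((((continuous_V_choice hc).comp_stronglyMeasurable ih).add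
      (h.measurable_noise n)).const_smul (γ n))

theorem IsMXLRun.history_le (h : G.IsMXLRun P γ σ Y Z) (hc : Continuous G.choice) (n : ℕ) :
    G.history Y n ≤ m0 := by
  let _ : MeasurableSpace (Profile G.M) := borel _
  have : BorelSpace (Profile G.M) := ⟨rfl⟩
  exact iSup₂_le fun k _ =>
    (hc.comp_stronglyMeasurable (h.stronglyMeasurable_score hc k)).measurable.comap_le

theorem history_mono (G : SemidefiniteGame N) (Y : ℕ → Ω → Profile G.M) :
    Monotone (G.history Y) := fun _ _ hnk =>
  iSup₂_le fun k hk => le_iSup₂_of_le k (hk.trans hnk) le_rfl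

/-- The filtration generated by the play. -/
noncomputable def IsMXLRun.filtration (h : G.IsMXLRun P γ σ Y Z) (hc : Continuous G.choice) : Filtration ℕ m0 where
  seq := G.history Y
  mono' := G.history_mono Y
  le' := h.history_le hc

theorem measurableSet_history (G : SemidefiniteGame N) (Y : ℕ → Ω → Profile G.M) (n : ℕ)
    {U : Set (Profile G.M)} (hU : IsOpen U) :
    MeasurableSet[G.history Y n] {ω | G.choice (Y n ω) ∈ U} := by
  have h1 : MeasurableSpace.comap (fun ω => G.choice (Y n ω)) (borel (Profile G.M)) ≤
      G.history Y n := le_iSup₂_of_le n le_rfl le_rfl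
  exact h1 _ ⟨U, MeasurableSpace.measurableSet_generateFrom hU, rfl⟩

/-- The choice map is injective, so the scores can be recovered from the actions. -/
theorem stronglyMeasurable_score_history (hc : Continuous G.choice) (Y : ℕ → Ω → Profile G.M)
    (n : ℕ) : StronglyMeasurable[G.history Y n] (Y n) := by
  exact stronglyMeasurable_of_comap_le (m := G.history Y n) hc G.choice_injective (le_iSup₂_of_le n le_rfl le_rfl)

/-- The history records only the actions, but these determine the scores, and the update rule can be
solved for the noise because γ n ≠ 0. Thus the noise is adapted with a delay of one step. -/
theorem IsMXLRun.stronglyMeasurable_noise_history (h : G.IsMXLRun P γ σ Y Z)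
    (hc : Continuous G.choice) (hγ : ∀ n, 0 < γ n) (n : ℕ) :
    StronglyMeasurable[G.history Y (n + 1)] (Z n) := by
  have h1 : Z n = fun ω => (γ n)⁻¹ • (Y (n + 1) ω - Y n ω) - G.V (G.choice (Y n ω)) := by
    ext1 ω
    rw [h.update n ω, add_sub_cancel_left, smul_smul, inv_mul_cancel₀ (hγ n).ne', one_smul,
      add_sub_cancel_left]
  have h2 := (stronglyMeasurable_score_history hc Y n).mono (G.history_mono Y (Nat.le_succ n))
  have h3 := stronglyMeasurable_score_history hc Y (n + 1)
  rw [h1]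
  exact ((h3.sub h2).const_smul (γ n)⁻¹).sub ((continuous_V_choice hc).comp_stronglyMeasurable h2)

theorem IsMXLRun.setIntegral_noise_sq_le [IsProbabilityMeasure P] (h : G.IsMXLRun P γ σ Y Z)
    (hc : Continuous G.choice) (n : ℕ) {A : Set Ω} (hA : MeasurableSet[G.history Y n] A) :
    ∫ ω in A, ‖Z n ω‖ ^ 2 ∂P ≤ σ ^ 2 * P.real A := by
  have hle := h.history_le hc n
  rw [← setIntegral_condExp hle (h.integrable_noise n 2 (by norm_num)) hA]
  -- For p = 2 the factor p!/2 equals 1.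
  have h1 : P[fun ω => ‖Z n ω‖ ^ 2 | G.history Y n] ≤ᵐ[P] fun _ => σ ^ 2 := by
    filter_upwards [h.subexponential n 2 (by norm_num)] with ω hω
    simpa using hω
  refine (setIntegral_mono_ae integrable_condExp.integrableOn
    (integrable_const _).integrableOn h1).trans (le_of_eq ?_)
  rw [setIntegral_const, smul_eq_mul, mul_comm]

theorem IsMXLRun.noise_bound [IsProbabilityMeasure P] (h : G.IsMXLRun P γ σ Y Z)
    (hc : Continuous G.choice) (hγ : ∀ n, 0 < γ n) :
    (∀ n, StronglyMeasurable[h.filtration hc (n + 1)] (Z n)) ∧ (∀ n, Integrable (Z n) P) ∧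
      ∀ n A, MeasurableSet[h.filtration hc 0] A → ∫ ω in A, ‖Z n ω‖ ^ 2 ∂P ≤ σ ^ 2 * P.real A := by
  refine ⟨h.stronglyMeasurable_noise_history hc hγ, fun n => ?_, fun n A hA =>
    h.setIntegral_noise_sq_le hc n (G.history_mono Y (Nat.zero_le n) A hA)⟩
  have h1 := h.integrable_noise n 1 le_rfl
  simp only [pow_one] at h1
  exact (integrable_norm_iff (h.measurable_noise n).aestronglyMeasurable).1 h1

end SemidefiniteGame

theorem mainTheorem6 {N : ℕ} (G : SemidefiniteGame N) (Xs : Profile G.M)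
    (hNash : G.IsNash Xs) (hD : G.HessianNegDef Xs)
    (σ : ℝ) (hσ : 0 < σ) (ε : ℝ) (hε : 0 < ε) :
    ∃ U : Set (Profile G.M), IsOpen U ∧ Xs ∈ U ∧ ∃ δ : ℝ, 0 < δ ∧
      ∀ γ : ℕ → ℝ, (∀ n, 0 < γ n) → ¬ Summable γ →
        (∃ q : ℝ, 0 < q ∧ q < 1 ∧ Summable fun n => γ n ^ (1 + q)) →
        ∑' n, γ n ^ 2 ≤ δ →
      ∀ (Ω : Type*) [MeasurableSpace Ω] (P : Measure Ω) [IsProbabilityMeasure P]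
        (Y Z : ℕ → Ω → Profile G.M), G.IsMXLRun P γ σ Y Z →
        P {ω | G.choice (Y 0 ω) ∈ U} ≠ 0 →
        1 - ε ≤ (ProbabilityTheory.cond P {ω | G.choice (Y 0 ω) ∈ U}).real
          {ω | Tendsto (fun n => G.choice (Y n ω)) atTop (𝓝 Xs)} := by
  obtain ⟨κ, c, C, R, hdesc⟩ := SemidefiniteGame.exists_isLocalDescent hNash hD
  obtain ⟨r, hr, θ, hθ, htend⟩ := hdesc.tendsto
  obtain ⟨K, hK, hnoise⟩ := exists_noise_bound (Profile G.M)
  have hc := hdesc.continuous_Q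
  -- The bound θ² on ∑ γ_n² forces every γ_n ≤ θ; the other bound makes the maximal inequality at
  -- level θ give a bad event of probability at most ε P(A).
  refine ⟨Metric.ball Xs r, Metric.isOpen_ball, Metric.mem_ball_self hr,
    min (θ ^ 2) (ε * θ ^ 2 / (K * σ ^ 2)), by positivity, ?_⟩
  intro γ hγ hγs ⟨q, hq0, hq1, hq⟩ hδ Ω _ P _ Y Z hrun hP
  have hsq := summable_sq_of_rpow hγ hq0 hq1 hq
  have hγθ : ∀ n, γ n ≤ θ := by
    intro n
    refine le_of_sq_le_sq ?_ hθ.le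
    exact (hsq.le_tsum n fun _ _ => sq_nonneg _).trans (hδ.trans (min_le_left _ _))
  have hγ0 : Tendsto γ atTop (𝓝 0) := by
    have h1 := (Real.continuous_sqrt.tendsto _).comp hsq.tendsto_atTop_zero
    rw [Real.sqrt_zero] at h1
    exact h1.congr fun n => Real.sqrt_sq (hγ n).le
  set A := {ω | G.choice (Y 0 ω) ∈ Metric.ball Xs r} with hAdef
  have hA : MeasurableSet[G.history Y 0] A := G.measurableSet_history Y 0 Metric.isOpen_ball
  have hA' : MeasurableSet A := hrun.history_le hc 0 A hA
  obtain ⟨hZ, hZ1, hZσ⟩ := hrun.noise_bound hc hγ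
  obtain ⟨hconv, hbound⟩ := hnoise (ℱ := hrun.filtration hc) hZ hZ1
    (fun n => hrun.integrable_noise n 2 (by norm_num)) hrun.zero_mean hZσ hsq
  have hbad := hbound A hA θ hθ
  set T := {ω | Tendsto (fun n => G.choice (Y n ω)) atTop (𝓝 Xs)} with hT
  have hTc : P (A ∩ Tᶜ) ≤ ENNReal.ofReal ε * P A := by
    refine le_trans (measure_mono_ae ?_) (hbad.trans ?_)
    · filter_upwards [hconv] with ω hω hmem
      refine ⟨hmem.1, ?_⟩
      by_contra hW
      have hW' : ∀ n, ‖∑ k ∈ Finset.range n, γ k • Z k ω‖ ≤ θ := fun n =>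
        not_lt.1 fun h => hW ⟨n, h⟩
      -- The accumulated noise starts with the empty sum W(0) = 0, and Y - W satisfies the noiseless
      -- recursion.
      refine hmem.2 (htend (fun n => Y n ω) (fun n => ∑ k ∈ Finset.range n, γ k • Z k ω) γ hγ hγθ
        hγ0 hγs hW' hω (fun n => ?_) (mem_ball_iff_norm.1 hmem.1))
      simp only [hrun.update n ω, Finset.sum_range_succ, smul_add]
      abel
    · rw [← ofReal_measureReal, ← ENNReal.ofReal_mul hε.le]
      refine ENNReal.ofReal_le_ofReal ?_
      have h1 : ∑' n, γ n ^ 2 ≤ ε * θ ^ 2 / (K * σ ^ 2) := hδ.trans (min_le_right _ _)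
      rw [le_div_iff₀ (by positivity)] at h1
      rw [div_le_iff₀ (by positivity)]
      have h2 := mul_le_mul_of_nonneg_right h1 (measureReal_nonneg (μ := P) (s := A))
      linarith
  have hprob : IsProbabilityMeasure (ProbabilityTheory.cond P A) := cond_isProbabilityMeasure hP
  have hcompl : (ProbabilityTheory.cond P A).real Tᶜ ≤ ε := by
    rw [measureReal_def, cond_apply hA']
    refine ENNReal.toReal_le_of_le_ofReal hε.le ?_
    calc (P A)⁻¹ * P (A ∩ Tᶜ) ≤ (P A)⁻¹ * (ENNReal.ofReal ε * P A) := by gcongr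
      _ = ENNReal.ofReal ε * ((P A)⁻¹ * P A) := by ring
      _ = ENNReal.ofReal ε := by rw [ENNReal.inv_mul_cancel hP (measure_ne_top P A), mul_one]
  have huniv := measureReal_union_le (μ := ProbabilityTheory.cond P A) T Tᶜ
  rw [Set.union_compl_self, probReal_univ] at huniv
  linarith
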